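/- Let $X$ be the (simplicial) complete toric surface of a complete fan in $\mathbb R^2$ with primitive ray generators $v_1,\dots,v_m$, let $S_X=\mathbb C[z_1,\dots,z_m]$ be its $Cl(X)$-graded homogeneous coordinate ring, and write $X=(\mathbb C^m\setminus Z)/G$ with $Z$ the irrelevant locus and $G=\mathrm{Hom}(Cl(X),\mathbb C^*)$. Let $\alpha=\sum_{i=1}^m A_i\,dz_i$ represent a global section of $\hat\Omega^1_X(\mathcal D)$ for some $\mathcal D\in Cl(X)$: the $A_i$ are homogeneous of degree $\mathcal D-\mathcal D_i$, and $\sum_i a_i z_iA_i=0$ for every relation $\sum_i a_iv_i=0$ $(a\in\mathbb Z^m)$. Let $n\ge m$, and let $F=(F_1,\dots,F_m)$, with $F_i\in S_{\mathbb P^n}=\mathbb C[x_0,\dots,x_n]$ homogeneous of degree $e_i$ and $\sum_i e_iv_i=0$, be a polynomial lifting of a rational map $\mathbb P^n\dashrightarrow X$. Put $\omega=F^*\alpha=\sum_i A_i(F)\,dF_i$. For a polynomial 1-form $\beta$, let $J(\beta)$ and $\mathscr C(d\beta)$ be the ideals generated by the coefficients of $\beta$ and of $d\beta$, and let $K(\beta)=(J(\beta):\mathscr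 C(d\beta))$ be the Kupka ideal. Let $Sing(\omega)$ and $\mathcal K(\omega)$ be the closed subschemes of $\mathbb P^n$ defined by $J(\omega)$ and $K(\omega)$. Let $C(F)\subseteq\mathbb P^n$ be the set of critical points of $F$, i.e. of the points $p$ such that $\mathrm{Im}\,dF(p)+T_{F(p)}(G\cdot F(p))\ne\mathbb C^m$ (where $F(p)\notin Z$ these are the critical points of the map to $X$; points of the base locus $F^{-1}(Z)$ are allowed), and let $$C(F,\alpha)=\{p\in C(F):\ \mathrm{Im}\,dF(p)\subseteq\mathrm{Ker}\,\alpha(F(p))\}.$$ The pair $(F,\alpha)$ is called generic if: (I) $\alpha(F(p))\neq 0$ for every $p\in C(F)$ with $F(p)\notin Z$ (no critical value of $F$ in $X$ is a singular point of $\alpha$), and the scheme $Sing(\omega)$ is reduced at every point of $C(F)$; (II) $J(\alpha)$ is radical of codimension $\ge2$; (III) $\mathscr C(d\alpha)$ has codimension $\ge 3$. **Theorem.** Suppose that $(F,\alpha)$ is a generic pair and that the ring homomorphism $F^*:S_X\to S_{\mathbb P^n}$, $z_i\mapsto F_i$, is flat. Then $$K(\omega)=\langle A_1(F),\dots,A_m(F)\rangle,$$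 the scheme $Sing(\omega)$ is reduced, and $Sing(\omega)=\mathcal K(\omega)\cup C(F,\alpha)$, both as subsets and as closed subschemes of $\mathbb P^n$, where $C(F,\alpha)$ carries the reduced structure. -/

import Mathlib

open scoped LinearAlgebra.Projectivization

noncomputable section

namespace ToricPullback

/-! ### Complete simplicial toric surfaces, through their fans -/

/-- The cone in `ℝ²` generated by the vectors `v i`, `i ∈ σ`. -/
def coneOf {m : ℕ} (v : Fin m → Fin 2 → ℤ) (σ : Finset (Fin m)) : Set (Fin 2 → ℝ) :=
  {x | ∃ c : Fin m → ℝ, (∀ i, 0 ≤ c i) ∧ ∀ k, x k = ∑ i ∈ σ, c i * (v i k : ℝ)}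

/-- A complete simplicial fan in `ℝ²` with `m` rays. `ray i` is the primitive generator of the
`i`-th ray, and a cone is recorded as the set of (indices of) rays which span it. -/
structure CompleteFan (m : ℕ) where
  ray : Fin m → Fin 2 → ℤ
  cones : Set (Finset (Fin m))
  primitive : ∀ i, IsCoprime (ray i 0) (ray i 1)
  ray_mem : ∀ i, {i} ∈ cones
  face_mem : ∀ σ ∈ cones, ∀ τ, τ ⊆ σ → τ ∈ cones
  simplicial : ∀ σ ∈ cones, LinearIndependent ℝ (fun (i : σ) (k : Fin 2) => (ray i k : ℝ))
  inter : ∀ σ ∈ cones, ∀ τ ∈ cones, coneOf ray σ ∩ coneOf ray τ = coneOf ray (σ ∩ τ)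
  complete : ∀ x : Fin 2 → ℝ, ∃ σ ∈ cones, x ∈ coneOf ray σ

variable {m n : ℕ}

/-- Integral linear relations `a₁ v₁ + ⋯ + aₘ vₘ = 0` among the rays. -/
def CompleteFan.IsRelation (Δ : CompleteFan m) (a : Fin m → ℤ) : Prop :=
  ∀ k, ∑ i, a i * Δ.ray i k = 0

/-- The irrelevant locus `Z ⊆ ℂᵐ`, the zero locus of the monomials `∏_{i ∉ σ} zᵢ`, `σ ∈ Δ`;
the toric surface is `X = (ℂᵐ \ Z) / G`. -/
def CompleteFan.irrelevantLocus (Δ : CompleteFan m) : Set (Fin m → ℂ) :=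
  {z | ∀ σ ∈ Δ.cones, ∏ i ∈ σᶜ, z i = 0}

/-- The tangent space at `z` of the orbit `G · z`, spanned by the values at `z` of the radial
vector fields `∑ aᵢ zᵢ ∂/∂zᵢ`, for `a` a relation among the rays. -/
def CompleteFan.orbitTangent (Δ : CompleteFan m) (z : Fin m → ℂ) : Submodule ℂ (Fin m → ℂ) :=
  Submodule.span ℂ {t | ∃ a : Fin m → ℤ, Δ.IsRelation a ∧ t = fun i => (a i : ℂ) * z i}

/-! ### Polynomial 1-forms

The form `∑ᵢ Aᵢ dzᵢ` is given by its coefficients `A`. -/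

/-- `∑ Aᵢ dzᵢ` is a global section of `Ω̂¹_X(𝒟)` with `𝒟 = ∑ Dₖ 𝒟ₖ`: it is homogeneous of degree
`[𝒟]` for the grading by `Cl(X) = ℤᵐ / {(⟨w, vₖ⟩)ₖ : w ∈ ℤ²}`, where `zₖ` and `dzₖ` have degree
`[𝒟ₖ]`, and its contraction with each radial vector field vanishes. -/
structure IsTwistedForm (Δ : CompleteFan m) (D : Fin m → ℤ)
    (A : Fin m → MvPolynomial (Fin m) ℂ) : Prop where
  homogeneous : ∀ i, ∀ u ∈ (A i).support, ∃ w : Fin 2 → ℤ, ∀ k,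
    (u k : ℤ) + (if k = i then 1 else 0) - D k = ∑ l, w l * Δ.ray k l
  descent : ∀ a : Fin m → ℤ, Δ.IsRelation a →
    ∑ i, MvPolynomial.C (a i : ℂ) * MvPolynomial.X i * A i = 0

section Forms

variable {σ : Type*}

/-- The singular ideal `J(α)`, generated by the coefficients of `α`. -/
def singularIdeal (A : σ → MvPolynomial σ ℂ) : Ideal (MvPolynomial σ ℂ) :=
  Ideal.span (Set.range A)

/-- The ideal `𝒞(dα)` generated by the coefficients of
`dα = ∑_{i<j} (∂Aⱼ/∂zᵢ - ∂Aᵢ/∂zⱼ) dzᵢ ∧ dzⱼ`. -/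
def dIdeal (A : σ → MvPolynomial σ ℂ) : Ideal (MvPolynomial σ ℂ) :=
  Ideal.span (Set.range fun p : σ × σ =>
    MvPolynomial.pderiv p.1 (A p.2) - MvPolynomial.pderiv p.2 (A p.1))

/-- The Kupka ideal `K(α) = (J(α) : 𝒞(dα))`, that is, the polynomials `f` with
`f dα ∈ J(α) Ω²`. -/
def kupkaIdeal (A : σ → MvPolynomial σ ℂ) : Ideal (MvPolynomial σ ℂ) :=
  (singularIdeal A).colon (dIdeal A : Set (MvPolynomial σ ℂ))

end Forms

/-! ### Pullback along a polynomial map `F = (F₁, …, Fₘ)` -/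

/-- `ω = F^*α = ∑ᵢ Aᵢ(F) dFᵢ`. -/
def pullback (F : Fin m → MvPolynomial (Fin (n + 1)) ℂ) (A : Fin m → MvPolynomial (Fin m) ℂ) :
    Fin (n + 1) → MvPolynomial (Fin (n + 1)) ℂ :=
  fun j => ∑ i, MvPolynomial.aeval F (A i) * MvPolynomial.pderiv j (F i)

/-- The point `F(x) ∈ ℂᵐ`. -/
def evalMap (F : Fin m → MvPolynomial (Fin (n + 1)) ℂ) (x : Fin (n + 1) → ℂ) : Fin m → ℂ :=
  fun i => MvPolynomial.eval x (F i)

/-- The differential `dF(x) : ℂⁿ⁺¹ → ℂᵐ`. -/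
def differential (F : Fin m → MvPolynomial (Fin (n + 1)) ℂ) (x : Fin (n + 1) → ℂ) :
    (Fin (n + 1) → ℂ) →ₗ[ℂ] (Fin m → ℂ) :=
  (Matrix.of fun i j => MvPolynomial.eval x (MvPolynomial.pderiv j (F i))).mulVecLin

/-- The critical set `C(F)`: the points `p` at which `dF(p)` does not map onto the normal space
`ℂᵐ / T(G · F(p))` of the orbit. If `F(p) ∉ Z` this normal space is the tangent space of
`X = (ℂᵐ \ Z) / G`, and `p` is critical for the map to `X`. The points of the base locus
`F⁻¹(Z)` at which the lifting degenerates are critical points as well. -/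
def criticalSet (Δ : CompleteFan m) (F : Fin m → MvPolynomial (Fin (n + 1)) ℂ) :
    Set (ℙ ℂ (Fin (n + 1) → ℂ)) :=
  {p | LinearMap.range (differential F p.rep) ⊔ Δ.orbitTangent (evalMap F p.rep) ≠ ⊤}

/-- `C(F, α) = {p ∈ C(F) : Im dF(p) ⊆ Ker α(F(p))}`. -/
def tangencySet (Δ : CompleteFan m) (F : Fin m → MvPolynomial (Fin (n + 1)) ℂ)
    (A : Fin m → MvPolynomial (Fin m) ℂ) : Set (ℙ ℂ (Fin (n + 1) → ℂ)) :=
  {p | p ∈ criticalSet Δ F ∧ ∀ t ∈ LinearMap.range (differential F p.rep),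
    ∑ i, MvPolynomial.eval (evalMap F p.rep) (A i) * t i = 0}

/-! ### Closed subschemes of `ℙⁿ` defined by homogeneous ideals -/

/-- The prime ideal of the point `x` of affine space. -/
def pointIdeal (x : Fin (n + 1) → ℂ) : Ideal (MvPolynomial (Fin (n + 1)) ℂ) :=
  RingHom.ker (MvPolynomial.eval x)

instance (x : Fin (n + 1) → ℂ) : (pointIdeal x).IsPrime :=
  RingHom.ker_isPrime _

/-- The ideal generated by `I` in the local ring of `ℂⁿ⁺¹` at a nonzero vector representing `p`.
As `ℂⁿ⁺¹ \ 0 → ℙⁿ` is a smooth surjection with pullback of `V(I) ⊆ ℙⁿ` the punctured cone over it,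
these ideals determine the subscheme `V(I)` near `p`, and detect whether it is reduced there. -/
def localIdeal (I : Ideal (MvPolynomial (Fin (n + 1)) ℂ)) (p : ℙ ℂ (Fin (n + 1) → ℂ)) :
    Ideal (Localization.AtPrime (pointIdeal p.rep)) :=
  I.map (algebraMap _ (Localization.AtPrime (pointIdeal p.rep)))

/-- The subscheme of `ℙⁿ` defined by `I` is reduced at `p` (vacuous if `p` does not lie on it). -/
def IsReducedAt (I : Ideal (MvPolynomial (Fin (n + 1)) ℂ)) (p : ℙ ℂ (Fin (n + 1) → ℂ)) : Prop :=
  IsReduced (Localization.AtPrime (pointIdeal p.rep) ⧸ localIdeal I p)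

/-- The homogeneous ideals `I` and `I'` define the same closed subscheme of `ℙⁿ`. -/
def SameSubscheme (I I' : Ideal (MvPolynomial (Fin (n + 1)) ℂ)) : Prop :=
  ∀ p : ℙ ℂ (Fin (n + 1) → ℂ), localIdeal I p = localIdeal I' p

/-- The zero set in `ℙⁿ` of a homogeneous ideal. -/
def projZeros (I : Ideal (MvPolynomial (Fin (n + 1)) ℂ)) : Set (ℙ ℂ (Fin (n + 1) → ℂ)) :=
  {p | ∀ f ∈ I, MvPolynomial.eval p.rep f = 0}

/-- The ideal of a subset of `ℙⁿ`: the polynomials which vanish on the cone over it. -/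
def idealOfSet (T : Set (ℙ ℂ (Fin (n + 1) → ℂ))) : Ideal (MvPolynomial (Fin (n + 1)) ℂ) :=
  MvPolynomial.vanishingIdeal ℂ
    {x : Fin (n + 1) → ℂ | ∃ h : x ≠ 0, Projectivization.mk ℂ x h ∈ T}

/-! ### Generic pairs -/

/-- The pair `(F, α)` is generic. -/
structure IsGenericPair (Δ : CompleteFan m) (F : Fin m → MvPolynomial (Fin (n + 1)) ℂ)
    (A : Fin m → MvPolynomial (Fin m) ℂ) : Prop where
  /-- No critical value of `F` in `X` is a singular point of `α`. -/
  critical_values : ∀ p ∈ criticalSet Δ F, evalMap F p.rep ∉ Δ.irrelevantLocus →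
    ∃ i, MvPolynomial.eval (evalMap F p.rep) (A i) ≠ 0
  /-- `Sing(ω)` is reduced along the critical set of `F`. -/
  reduced_along : ∀ p ∈ criticalSet Δ F, IsReducedAt (singularIdeal (pullback F A)) p
  radical : (singularIdeal A).IsRadical
  codim_singular : 2 ≤ (singularIdeal A).height
  codim_d : 3 ≤ (dIdeal A).height

end ToricPullback

end

/-! Write I = ⟨A₁(F), …, Aₘ(F)⟩ (`pulledIdeal`), the extension of J(α) along F^*. Contraction with
the radial fields forces α ∧ dα = 0, so A_i(F) dω is a multiple of ω and I ⊆ K(ω). Conversely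
K(ω)·𝒞(dω) ⊆ J(ω) ⊆ I, so K(ω) = I once no associated prime Q of I contains 𝒞(dω). Everything rests
on the local structure of I at such a Q.

By flatness Q contracts to a minimal prime P of the radical ideal J(α). If dα vanished along P, the
Jacobian matrix of A there would be symmetric and the relations among the rays would bound its rank
by 2 (`rank_symmetric_le_two`), whereas P would have height at least 3. So some coefficient (dα)_ab
is a unit at P, and integrability makes A_a, A_b generate J(α) there. Since P has height at least 2,
this pair becomes a regular sequence at Q. A regular local ring of dimension at least 3 modulo a
regular pair has no socle, so Q has height 2 and is minimal over I (`exists_isLocalPair`).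

Next, I is reduced at Q. Being homogeneous of height 2 ≤ n, Q passes through a point p of ℙⁿ. If p
is not critical, the gradients of A_a(F), A_b(F) are independent along Q and generate it locally. If
p is critical, write ω = f w with w free of common factors: an argument with derivations shows that
w vanishes along Q, and reducedness of Sing(ω) at p then excludes f ∈ Q and makes J(ω), hence I,
equal to Q locally. So I is radical. Locally at Q, dA_a(F) ∧ dA_b(F) is a multiple of dω modulo I;
if dω vanished along Q, the Jacobian criterion would give height at most 1.

Finally J(ω) and I agree near noncritical points, while the zeros of ω among critical points form
C(F, α) by definition. As Sing(ω) is reduced everywhere, the Nullstellensatz turns the equality of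
sets into one of schemes. -/

namespace ToricPullback

universe u

/-! ### Regular local rings: they are domains, and regular pairs have no socle in dimension at least
three. -/

section RegularLocal

open IsLocalRing

variable {A : Type*} [CommRing A]

/-- The quotient of a regular local ring by an element of `m \ m²` is regular of dimension one
less. -/
theorem isRegularLocalRing_quotient_singleton [IsRegularLocalRing A] {y : A}
    (hy : y ∈ maximalIdeal A) (hy2 : y ∉ maximalIdeal A ^ 2) :
    IsRegularLocalRing (A ⧸ Ideal.span {y}) ∧
      ringKrullDim (A ⧸ Ideal.span {y}) + 1 = ringKrullDim A := by
  classical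
  let K := ResidueField A
  let V := CotangentSpace A
  let v0 : V := (maximalIdeal A).toCotangent ⟨y, hy⟩
  have hv0 : v0 ≠ 0 := fun h => hy2 ((Ideal.toCotangent_eq_zero _ _).1 h)
  let W : Submodule K V := Submodule.span K {v0}
  have hne : Ideal.span {y} ≠ ⊤ := fun h => (Ideal.IsPrime.ne_top' : maximalIdeal A ≠ ⊤)
    (top_le_iff.1 (h ▸ (Ideal.span_singleton_le_iff_mem _).2 hy))
  have : Nontrivial (A ⧸ Ideal.span {y}) := Ideal.Quotient.nontrivial_iff.2 hne
  have : IsLocalRing (A ⧸ Ideal.span {y}) :=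
    IsLocalRing.of_surjective' _ Ideal.Quotient.mk_surjective
  have hfr : Module.finrank K (V ⧸ W) + 1 = Module.finrank K V := by
    rw [← Submodule.finrank_quotient_add_finrank W, finrank_span_singleton hv0]
  set k := Module.finrank K (V ⧸ W) with hk
  let b := Module.finBasis K (V ⧸ W)
  have hlift : ∀ i, ∃ a : maximalIdeal A,
      W.mkQ ((maximalIdeal A).toCotangent a) = b i := fun i => by
    obtain ⟨v, hv⟩ := W.mkQ_surjective (b i)
    obtain ⟨a, rfl⟩ := Ideal.toCotangent_surjective _ v
    exact ⟨a, hv⟩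
  choose a ha using hlift
  have hspan : Submodule.span A (insert ⟨y, hy⟩ (Set.range a)) = ⊤ := by
    rw [← CotangentSpace.span_image_eq_top_iff, Set.image_insert_eq]
    have h1 : (Submodule.span K ((maximalIdeal A).toCotangent '' Set.range a)).map W.mkQ = ⊤ := by
      rw [Submodule.map_span, ← Set.range_comp, ← Set.range_comp, ← b.span_eq]
      congr 2
      ext i
      exact ha i
    rw [Submodule.span_insert]
    change W ⊔ _ = ⊤
    rw [← Submodule.comap_map_mkQ, h1, Submodule.comap_top]
  have hm : maximalIdeal A = Ideal.span (insert y (Set.range fun i => (a i : A))) := by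
    have := congrArg (Submodule.map (maximalIdeal A).subtype) hspan
    rw [Submodule.map_span, Submodule.map_top, Submodule.range_subtype, Set.image_insert_eq,
      ← Set.range_comp] at this
    exact this.symm
  have hmq : maximalIdeal (A ⧸ Ideal.span {y}) =
      Ideal.span (Set.range fun i => Ideal.Quotient.mk (Ideal.span {y}) (a i : A)) := by
    have h1 : maximalIdeal (A ⧸ Ideal.span {y}) =
        (maximalIdeal A).map (Ideal.Quotient.mk (Ideal.span {y})) :=
      (IsLocalRing.map_maximalIdeal_of_surjective _ Ideal.Quotient.mk_surjective).symm
    rw [h1, congrArg (Ideal.map (Ideal.Quotient.mk (Ideal.span {y}))) hm,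
      Ideal.map_span, Set.image_insert_eq, ← Set.range_comp]
    have : Ideal.Quotient.mk (Ideal.span {y}) y = 0 :=
      Ideal.Quotient.eq_zero_iff_mem.2 (Ideal.mem_span_singleton_self y)
    rw [this, Ideal.span_insert_zero]
    rfl
  have hle : (maximalIdeal (A ⧸ Ideal.span {y})).spanFinrank ≤ k := by
    rw [hmq]
    refine (Submodule.spanFinrank_span_le_ncard_of_finite (Set.finite_range _)).trans ?_
    rw [← Set.image_univ]
    refine (Set.ncard_image_le Set.finite_univ).trans ?_
    simp [Set.ncard_univ, k, K, V]
  have hdim : ringKrullDim A = ((k + 1 : ℕ) : WithBot ℕ∞) := by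
    rw [hfr]
    exact ((IsRegularLocalRing.iff_finrank_cotangentSpace A).1 inferInstance).symm
  -- The dimension drops by at most one and the embedding dimension by at least one, so equality
  -- holds throughout.
  have h1 : ringKrullDim A ≤ ringKrullDim (A ⧸ Ideal.span {y}) + 1 := by
    have := ringKrullDim_le_ringKrullDim_quotient_add_card (R := A) {y} (by
      rw [IsLocalRing.ringJacobson_eq_maximalIdeal]; simpa using hy)
    rwa [Finset.coe_singleton, Finset.card_singleton, Nat.cast_one] at this
  have h2 := ringKrullDim_le_spanFinrank_maximalIdeal (A ⧸ Ideal.span {y})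
  have h3 : ringKrullDim (A ⧸ Ideal.span {y}) ≤ (k : WithBot ℕ∞) :=
    h2.trans (by exact_mod_cast hle)
  have h4 : (k : WithBot ℕ∞) ≤ ringKrullDim (A ⧸ Ideal.span {y}) := by
    rw [hdim] at h1
    push_cast at h1
    exact ENat.WithBot.add_le_add_natCast_right_iff.1 h1
  refine ⟨.of_spanFinrank_maximalIdeal_le _ (le_trans (by exact_mod_cast hle) h4), ?_⟩
  rw [hdim, le_antisymm h3 h4]
  push_cast
  rfl

theorem exists_mem_maximalIdeal_notMem_sq [IsLocalRing A] [IsNoetherianRing A]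
    (h : maximalIdeal A ≠ ⊥) : ∃ y ∈ maximalIdeal A, y ∉ maximalIdeal A ^ 2 := by
  by_contra! hc
  refine h (Submodule.eq_bot_of_le_smul_of_le_jacobson_bot (maximalIdeal A) _
    (IsNoetherian.noetherian _) ?_ (maximalIdeal_le_jacobson _))
  intro y hy
  simpa [pow_two] using hc y hy

/-- Induction on the dimension: for y in m outside m² and outside every minimal prime, A/(y) is a
domain, so (y) contains a minimal prime p. As y ∉ p, p = y p, and Nakayama gives p = 0. -/
theorem isDomain_of_isRegularLocalRing_of_dim (d : ℕ) : ∀ (A : Type u) [CommRing A]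
    [IsRegularLocalRing A], ringKrullDim A = d → IsDomain A := by
  induction d with
  | zero =>
    intro A _ _ hd
    have h0 : maximalIdeal A = ⊥ := by
      have h1 : (maximalIdeal A).spanFinrank = 0 := by
        have := (isRegularLocalRing_iff A).1 inferInstance
        rw [hd] at this
        exact_mod_cast this
      exact (Submodule.spanFinrank_eq_zero_iff_eq_bot (IsNoetherian.noetherian _)).1 h1
    exact (IsLocalRing.isField_iff_maximalIdeal_eq.2 h0).isDomain
  | succ d ih =>
    intro A _ _ hd
    have hm : maximalIdeal A ≠ ⊥ := by
      intro h
      have h1 := (isRegularLocalRing_iff A).1 inferInstance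
      rw [h, hd] at h1
      simp at h1
      exact absurd h1.symm (by exact_mod_cast Nat.succ_ne_zero d)
    classical
    have hfin := (minimalPrimes.finite_of_isNoetherianRing A)
    have hmin : ∀ p ∈ minimalPrimes A, ¬ maximalIdeal A ≤ p := by
      intro p hp hle
      have : p.IsPrime := Ideal.IsMinimalPrime.isPrime hp
      have hpm : p = maximalIdeal A := le_antisymm (le_maximalIdeal Ideal.IsPrime.ne_top') hle
      have h0 := Ideal.height_eq_zero_iff.2 (hpm ▸ hp)
      have h1 := IsLocalRing.maximalIdeal_height_eq_ringKrullDim (R := A)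
      rw [h0, hd] at h1
      exact absurd h1.symm (by exact_mod_cast Nat.succ_ne_zero d)
    obtain ⟨y, hy, hy2, hyp⟩ : ∃ y ∈ maximalIdeal A, y ∉ maximalIdeal A ^ 2 ∧
        ∀ p ∈ minimalPrimes A, y ∉ p := by
      by_contra! hc
      -- Prime avoidance tolerates two non-prime members; m² fills both exceptional slots.
      have := (Ideal.subset_union_prime (R := A)
        (s := insert (maximalIdeal A ^ 2) hfin.toFinset) (f := id) (maximalIdeal A ^ 2)
        (maximalIdeal A ^ 2) (fun i hi h1 _ => by
          rw [Finset.mem_insert] at hi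
          exact Ideal.IsMinimalPrime.isPrime (hfin.mem_toFinset.1 (hi.resolve_left h1)))
        (I := maximalIdeal A)).1 (by
          intro y hy
          by_cases h2 : y ∈ maximalIdeal A ^ 2
          · simp only [Set.mem_iUnion]
            exact ⟨maximalIdeal A ^ 2, by simp, h2⟩
          · obtain ⟨p, hp, hyp⟩ := hc y hy h2
            simp only [Set.mem_iUnion]
            exact ⟨p, by simp [hp], hyp⟩)
      obtain ⟨i, hi, hle⟩ := this
      rw [Finset.mem_insert] at hi
      rcases hi with rfl | hi
      · obtain ⟨y, hy, hy2⟩ := exists_mem_maximalIdeal_notMem_sq hm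
        exact hy2 (hle hy)
      · exact hmin i (hfin.mem_toFinset.1 hi) hle
    obtain ⟨hreg, hdim⟩ := isRegularLocalRing_quotient_singleton hy hy2
    have hd' : ringKrullDim (A ⧸ Ideal.span {y}) = d := by
      rw [hd] at hdim
      push_cast at hdim
      exact le_antisymm (ENat.WithBot.add_le_add_natCast_right_iff.1 hdim.le)
        (ENat.WithBot.add_le_add_natCast_right_iff.1 hdim.ge)
    have := ih _ hd'
    have hprime : (Ideal.span {y}).IsPrime := (Ideal.Quotient.isDomain_iff_prime _).1 this
    obtain ⟨p, hp, hle⟩ := Ideal.exists_minimalPrimes_le (I := ⊥) (J := Ideal.span {y}) bot_le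
    have : p.IsPrime := Ideal.IsMinimalPrime.isPrime hp
    have hpb : p = ⊥ := by
      refine Submodule.eq_bot_of_le_smul_of_le_jacobson_bot (maximalIdeal A) _
        (IsNoetherian.noetherian _) ?_ (maximalIdeal_le_jacobson _)
      intro z hz
      obtain ⟨c, rfl⟩ := Ideal.mem_span_singleton.1 (hle hz)
      exact Submodule.smul_mem_smul hy
        ((Ideal.IsPrime.mem_or_mem ‹_› hz).resolve_left (hyp p hp))
    subst hpb
    exact IsDomain.of_bot_isPrime A

theorem isDomain_of_isRegularLocalRing (A : Type*) [CommRing A] [IsRegularLocalRing A] :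
    IsDomain A := by
  have h := (isRegularLocalRing_iff A).1 inferInstance
  exact isDomain_of_isRegularLocalRing_of_dim _ A h.symm

/-- The length three part of "depth is independent of the regular sequence". -/
theorem mem_span_pair_of_regular {x y y₁ y₂ y₃ g : A}
    (hx : ∀ r, x * r = 0 → r = 0) (hy : ∀ r, y * r ∈ Ideal.span {x} → r ∈ Ideal.span {x})
    (h1 : ∀ r, y₁ * r = 0 → r = 0)
    (h2 : ∀ r, y₂ * r ∈ Ideal.span {y₁} → r ∈ Ideal.span {y₁})
    (h3 : ∀ r, y₃ * r ∈ Ideal.span {y₁, y₂} → r ∈ Ideal.span {y₁, y₂})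
    (hg1 : y₁ * g ∈ Ideal.span {x, y}) (hg2 : y₂ * g ∈ Ideal.span {x, y})
    (hg3 : y₃ * g ∈ Ideal.span {x, y}) : g ∈ Ideal.span {x, y} := by
  -- The only syzygies of a regular pair are the Koszul ones.
  have key : ∀ {r s : A}, r * x + s * y = 0 → ∃ t, s = t * x ∧ r = -(t * y) := by
    intro r s h
    obtain ⟨t, ht⟩ := Ideal.mem_span_singleton.1 (hy s (Ideal.mem_span_singleton.2
      ⟨-r, by linear_combination h⟩))
    refine ⟨t, by rw [ht, mul_comm], ?_⟩
    have : x * (r + t * y) = 0 := by rw [ht] at h; linear_combination h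
    linear_combination hx _ this
  simp only [Ideal.mem_span_pair] at hg1 hg2 hg3 h3 ⊢
  simp only [Ideal.mem_span_singleton] at h2
  obtain ⟨u₁, v₁, e1⟩ := hg1
  obtain ⟨u₂, v₂, e2⟩ := hg2
  obtain ⟨u₃, v₃, e3⟩ := hg3
  obtain ⟨t12, a12, b12⟩ := key (r := y₂ * u₁ - y₁ * u₂) (s := y₂ * v₁ - y₁ * v₂)
    (by linear_combination y₂ * e1 - y₁ * e2)
  obtain ⟨t23, a23, b23⟩ := key (r := y₃ * u₂ - y₂ * u₃) (s := y₃ * v₂ - y₂ * v₃)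
    (by linear_combination y₃ * e2 - y₂ * e3)
  obtain ⟨t31, a31, b31⟩ := key (r := y₁ * u₃ - y₃ * u₁) (s := y₁ * v₃ - y₃ * v₁)
    (by linear_combination y₁ * e3 - y₃ * e1)
  -- Cyclic relation among the Koszul coefficients. Regularity of y₃ puts t12 in (y₁, y₂);
  -- correcting u₁, v₁ by the coefficient β makes both divisible by y₁, which then cancels.
  have hc : y₃ * t12 + y₁ * t23 + y₂ * t31 = 0 := hx _ (by
    linear_combination -y₃ * a12 - y₁ * a23 - y₂ * a31)
  obtain ⟨α, β, hαβ⟩ := h3 t12 ⟨-t23, -t31, by linear_combination -hc⟩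
  obtain ⟨δ, hδ⟩ := h2 (v₁ - β * x) ⟨v₂ + α * x, by linear_combination a12 - x * hαβ⟩
  obtain ⟨ε, hε⟩ := h2 (u₁ + β * y) ⟨u₂ - α * y, by linear_combination b12 + y * hαβ⟩
  refine ⟨ε, δ, ?_⟩
  have : y₁ * (g - (ε * x + δ * y)) = 0 := by
    linear_combination -e1 + x * hε + y * hδ
  linear_combination -h1 _ this

/-- In a regular local ring, a complete intersection of codimension two whose embedded dimension
is at least three has no socle. -/
theorem ringKrullDim_le_two_of_socle [IsRegularLocalRing A] {x y g : A}
    (hx : ∀ r, x * r = 0 → r = 0) (hy : ∀ r, y * r ∈ Ideal.span {x} → r ∈ Ideal.span {x})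
    (hg : g ∉ Ideal.span {x, y}) (hmg : ∀ z ∈ maximalIdeal A, z * g ∈ Ideal.span {x, y}) :
    ringKrullDim A ≤ 2 := by
  by_contra hdim
  have hdim3 : 2 < ringKrullDim A := not_le.1 hdim
  have hbot : ∀ (B : Type _) [CommRing B] [IsRegularLocalRing B], 0 < ringKrullDim B →
      maximalIdeal B ≠ ⊥ := by
    intro B _ _ h hb
    have h1 := (isRegularLocalRing_iff B).1 inferInstance
    rw [hb] at h1
    simp at h1
    rw [← h1] at h
    exact lt_irrefl _ h
  have := isDomain_of_isRegularLocalRing A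
  -- Dimension above 2 leaves room for three successive cuts by elements of m ∖ m². Each quotient is
  -- again regular, hence a domain, so y₁, y₂, y₃ is a regular sequence.
  obtain ⟨y₁, m1, n1⟩ := exists_mem_maximalIdeal_notMem_sq
    (hbot A (lt_trans (by norm_num) hdim3))
  obtain ⟨r1, d1⟩ := isRegularLocalRing_quotient_singleton m1 n1
  have hd1 : 1 < ringKrullDim (A ⧸ Ideal.span {y₁}) := by
    by_contra hc
    have := add_le_add_left (not_lt.1 hc) 1
    rw [d1] at this
    exact absurd this (not_le.2 (lt_of_eq_of_lt (by norm_num) hdim3))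
  have := isDomain_of_isRegularLocalRing (A ⧸ Ideal.span {y₁})
  obtain ⟨y₂', m2, n2⟩ := exists_mem_maximalIdeal_notMem_sq
    (hbot (A ⧸ Ideal.span {y₁}) (lt_trans (by norm_num) hd1))
  obtain ⟨r2, d2⟩ := isRegularLocalRing_quotient_singleton m2 n2
  have hd2 : 0 < ringKrullDim ((A ⧸ Ideal.span {y₁}) ⧸ Ideal.span {y₂'}) := by
    by_contra hc
    have := add_le_add_left (not_lt.1 hc) 1
    rw [d2] at this
    exact absurd this (not_le.2 (lt_of_eq_of_lt (by norm_num) hd1))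
  have := isDomain_of_isRegularLocalRing ((A ⧸ Ideal.span {y₁}) ⧸ Ideal.span {y₂'})
  obtain ⟨y₃', m3, n3⟩ := exists_mem_maximalIdeal_notMem_sq
    (hbot ((A ⧸ Ideal.span {y₁}) ⧸ Ideal.span {y₂'}) hd2)
  obtain ⟨y₂, rfl⟩ := Ideal.Quotient.mk_surjective y₂'
  obtain ⟨y₃', rfl⟩ := Ideal.Quotient.mk_surjective y₃'
  obtain ⟨y₃, rfl⟩ := Ideal.Quotient.mk_surjective y₃'
  have max_of : ∀ {B : Type _} [CommRing B] [IsLocalRing B] {J : Ideal B} [IsLocalRing (B ⧸ J)]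
      {b : B}, Ideal.Quotient.mk J b ∈ maximalIdeal (B ⧸ J) → b ∈ maximalIdeal B := by
    intro B _ _ J _ b hb
    rw [mem_maximalIdeal, mem_nonunits_iff] at hb ⊢
    exact fun h => hb (h.map _)
  refine hg (mem_span_pair_of_regular hx hy (y₁ := y₁) (y₂ := y₂) (y₃ := y₃) ?_ ?_ ?_
    (hmg _ m1) (hmg _ (max_of m2)) (hmg _ (max_of (max_of m3))))
  · intro r hr
    refine (mul_eq_zero.1 hr).resolve_left ?_
    rintro rfl
    exact n1 (zero_mem _)
  · intro r hr
    rw [← Ideal.Quotient.eq_zero_iff_mem, map_mul] at hr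
    refine Ideal.Quotient.eq_zero_iff_mem.1 ((mul_eq_zero.1 hr).resolve_left ?_)
    intro h
    rw [h] at n2
    exact n2 (zero_mem _)
  · have hiff : ∀ r : A, Ideal.Quotient.mk (Ideal.span {Ideal.Quotient.mk (Ideal.span {y₁}) y₂})
        (Ideal.Quotient.mk (Ideal.span {y₁}) r) = 0 ↔ r ∈ Ideal.span {y₁, y₂} := by
      intro r
      rw [Ideal.Quotient.eq_zero_iff_mem, Ideal.mem_span_singleton, Ideal.mem_span_pair]
      constructor
      · rintro ⟨c, hc⟩
        obtain ⟨c, rfl⟩ := Ideal.Quotient.mk_surjective c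
        rw [← map_mul, Ideal.Quotient.eq, Ideal.mem_span_singleton] at hc
        obtain ⟨e, he⟩ := hc
        exact ⟨e, c, by linear_combination -he⟩
      · rintro ⟨e, c, rfl⟩
        refine ⟨Ideal.Quotient.mk _ c, ?_⟩
        rw [← map_mul, Ideal.Quotient.eq, Ideal.mem_span_singleton]
        exact ⟨e, by ring⟩
    intro r hr
    rw [← hiff] at hr ⊢
    rw [map_mul, map_mul] at hr
    refine (mul_eq_zero.1 hr).resolve_left ?_
    intro h
    rw [h] at n3
    exact n3 (zero_mem _)

end RegularLocal

end ToricPullback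

namespace ToricPullback

/-! ### A Jacobian criterion for primes of a polynomial ring over ℂ. -/

section Jacobian

open IsLocalRing MvPolynomial TensorProduct

variable {σ ι : Type*} [Fintype σ]

theorem derivation_eq_sum_pderiv {M : Type*} [AddCommGroup M] [Module ℂ M]
    [Module (MvPolynomial σ ℂ) M] [IsScalarTower ℂ (MvPolynomial σ ℂ) M]
    (d : Derivation ℂ (MvPolynomial σ ℂ) M) (f : MvPolynomial σ ℂ) :
    d f = ∑ j, pderiv j f • d (X j) := by
  classical
  induction f using MvPolynomial.induction_on with
  | C a => simp [MvPolynomial.derivation_C]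
  | add p q hp hq => simp only [map_add, hp, hq, add_smul, Finset.sum_add_distrib]
  | mul_X p i hp =>
    simp only [Derivation.leibniz, hp, add_smul, Finset.sum_add_distrib, pderiv_X, smul_eq_mul,
      mul_smul, Finset.smul_sum]
    congr 1
    rw [Finset.sum_eq_single i (fun j _ hj => by simp [hj.symm]) (by simp)]
    simp

/-- The residue field is formally smooth over ℂ (characteristic zero), so m/m² embeds in κ ⊗ Ω of
the local ring; there the class is given by the gradient, which vanishes. -/
theorem cotangent_eq_zero_of_gradient_eq_zero (P : Ideal (MvPolynomial σ ℂ)) [P.IsPrime]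
    [Fintype ι] (f : ι → MvPolynomial σ ℂ) (hf : ∀ i, f i ∈ P)
    (l : ι → Localization.AtPrime P)
    (h : ∀ j, ∑ i, residue _ (l i) * algebraMap _ P.ResidueField (pderiv j (f i)) = 0) :
    ∑ i, l i * algebraMap _ (Localization.AtPrime P) (f i) ∈
      maximalIdeal (Localization.AtPrime P) ^ 2 := by
  let L := Localization.AtPrime P
  have hsurj : Function.Surjective (algebraMap L P.ResidueField) := residue_surjective
  have hker : RingHom.ker (algebraMap L P.ResidueField) = maximalIdeal L := ker_residue
  have hinj : Function.Injective
      (KaehlerDifferential.kerCotangentToTensor ℂ L P.ResidueField) := by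
    have : Algebra.FormallySmooth ℂ L := inferInstance
    have h1 : Algebra.EssFiniteType ℂ P.ResidueField :=
      Algebra.EssFiniteType.comp ℂ (MvPolynomial σ ℂ) P.ResidueField
    have h2 : Algebra.FormallySmooth ℂ P.ResidueField := Algebra.FormallySmooth.of_perfectField
    rw [Algebra.FormallySmooth.kerCotangentToTensor_injective_iff hsurj]
    infer_instance
  have hfL : ∀ i, algebraMap _ L (f i) ∈ maximalIdeal L := fun i =>
    (IsLocalization.AtPrime.to_map_mem_maximal_iff L P _).2 (hf i)
  have hq : ∑ i, l i * algebraMap _ L (f i) ∈ RingHom.ker (algebraMap L P.ResidueField) := by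
    rw [hker]
    exact Ideal.sum_mem _ fun i _ => Ideal.mul_mem_left _ _ (hfL i)
  have h0 : KaehlerDifferential.kerCotangentToTensor ℂ L P.ResidueField
      (Ideal.toCotangent _ ⟨_, hq⟩) = 0 := by
    rw [KaehlerDifferential.kerCotangentToTensor_toCotangent]
    have hD : ∀ g : MvPolynomial σ ℂ, KaehlerDifferential.D ℂ L (algebraMap _ L g) =
        ∑ j, algebraMap _ L (pderiv j g) •
          KaehlerDifferential.D ℂ L (algebraMap (MvPolynomial σ ℂ) L (X j)) := by
      intro g
      have := derivation_eq_sum_pderiv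
        ((KaehlerDifferential.D ℂ L).compAlgebraMap (MvPolynomial σ ℂ)) g
      refine Eq.trans this (Finset.sum_congr rfl fun j _ => ?_)
      exact (algebraMap_smul L (pderiv j g)
        (KaehlerDifferential.D ℂ L (algebraMap (MvPolynomial σ ℂ) L (X j)))).symm
    have hs : ∀ (c : P.ResidueField) (a : L) (w : Ω[L⁄ℂ]),
        c ⊗ₜ[L] (a • w) = (c * algebraMap L P.ResidueField a) ⊗ₜ[L] w := fun c a w => by
      rw [← (TensorProduct.smul_tmul a c w), Algebra.smul_def, mul_comm]
    have h1 : ∀ i, (1 : P.ResidueField) ⊗ₜ[L] KaehlerDifferential.D ℂ L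
        (l i * algebraMap _ L (f i)) = ∑ j, (residue _ (l i) *
          algebraMap _ P.ResidueField (pderiv j (f i))) ⊗ₜ[L]
            KaehlerDifferential.D ℂ L (algebraMap (MvPolynomial σ ℂ) L (X j)) := by
      intro i
      have e0 : algebraMap L P.ResidueField (algebraMap _ L (f i)) = 0 :=
        (residue_eq_zero_iff _).2 (hfL i)
      rw [Derivation.leibniz, TensorProduct.tmul_add, hs, hs, one_mul, one_mul, e0,
        TensorProduct.zero_tmul, add_zero, hD, TensorProduct.tmul_sum]
      exact Finset.sum_congr rfl fun j _ => hs _ _ _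
    change (1 : P.ResidueField) ⊗ₜ[L] KaehlerDifferential.D ℂ L
        (∑ i, l i * algebraMap _ L (f i)) = 0
    rw [map_sum, TensorProduct.tmul_sum, Finset.sum_congr rfl fun i _ => h1 i, Finset.sum_comm]
    refine Finset.sum_eq_zero fun j _ => ?_
    rw [← TensorProduct.sum_tmul, h j, TensorProduct.zero_tmul]
  have h1 := hinj (h0.trans (map_zero _).symm)
  rw [Ideal.toCotangent_eq_zero] at h1
  exact hker ▸ h1

theorem height_eq_finrank_cotangentSpace (P : Ideal (MvPolynomial σ ℂ)) [P.IsPrime] :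
    P.height = Module.finrank (ResidueField (Localization.AtPrime P))
      (CotangentSpace (Localization.AtPrime P)) := by
  have h1 := (IsRegularLocalRing.iff_finrank_cotangentSpace (Localization.AtPrime P)).1
    inferInstance
  rw [IsLocalization.AtPrime.ringKrullDim_eq_height P] at h1
  exact_mod_cast h1.symm

/-- A Jacobian criterion: a prime generated locally by `f` has height at most the rank of the
Jacobian matrix of `f` at its generic point. -/
theorem height_le_rank_jacobian (P : Ideal (MvPolynomial σ ℂ)) [P.IsPrime] [Fintype ι]
    (f : ι → MvPolynomial σ ℂ) (hf : ∀ i, f i ∈ P)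
    (hgen : ∀ q ∈ P, ∃ s ∉ P, s * q ∈ Ideal.span (Set.range f)) :
    P.height ≤ (Matrix.of fun i j => algebraMap _ P.ResidueField (pderiv j (f i))).rank := by
  classical
  let L := Localization.AtPrime P
  have hfL : ∀ i, algebraMap _ L (f i) ∈ maximalIdeal L := fun i =>
    (IsLocalization.AtPrime.to_map_mem_maximal_iff L P _).2 (hf i)
  let M : Matrix ι σ P.ResidueField :=
    Matrix.of fun i j => algebraMap _ P.ResidueField (pderiv j (f i))
  let v : ι → CotangentSpace L := fun i => (maximalIdeal L).toCotangent ⟨_, hfL i⟩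
  let Φ : (ι → P.ResidueField) →ₗ[P.ResidueField] CotangentSpace L :=
    Fintype.linearCombination P.ResidueField v
  have hspan : Submodule.span L (Set.range fun i => (⟨_, hfL i⟩ : maximalIdeal L)) = ⊤ := by
    have hmap : Ideal.span (Set.range fun i => algebraMap _ L (f i)) = maximalIdeal L := by
      refine le_antisymm (Ideal.span_le.2 (by rintro _ ⟨i, rfl⟩; exact hfL i)) ?_
      rw [← Localization.AtPrime.map_eq_maximalIdeal, Ideal.map_le_iff_le_comap]
      intro q hq
      obtain ⟨s, hs, hsq⟩ := hgen q hq
      have h1 := Ideal.mem_map_of_mem (algebraMap _ L) hsq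
      rw [Ideal.map_span, ← Set.range_comp, map_mul] at h1
      have hu : IsUnit (algebraMap _ L s) := IsLocalization.map_units L (⟨s, hs⟩ : P.primeCompl)
      exact (Ideal.unit_mul_mem_iff_mem _ hu).1 h1
    apply Submodule.map_injective_of_injective (maximalIdeal L).injective_subtype
    rw [Submodule.map_span, ← Set.range_comp, Submodule.map_top, Submodule.range_subtype]
    exact hmap
  have hsurj : LinearMap.range Φ = ⊤ := by
    rw [Fintype.range_linearCombination]
    have := CotangentSpace.span_image_eq_top_iff.2 hspan
    rwa [← Set.range_comp] at this
  -- The surjection Φ onto the cotangent space factors through the row space of the Jacobian matrix,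
  -- and the cotangent space has dimension the height of P.
  have hker : LinearMap.ker M.vecMulLinear ≤ LinearMap.ker Φ := by
    intro c hc
    have hl : ∀ i, ∃ l : L, residue L l = c i := fun i => residue_surjective (c i)
    choose l hl using hl
    have h0 := cotangent_eq_zero_of_gradient_eq_zero P f hf l (by
      intro j
      have := congrFun (LinearMap.mem_ker.1 hc) j
      simp only [Matrix.vecMulLinear_apply, Matrix.vecMul, dotProduct] at this
      refine Eq.trans (Finset.sum_congr rfl fun i _ => ?_) this
      rw [hl i]
      rfl)
    rw [LinearMap.mem_ker, Fintype.linearCombination_apply]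
    have h1 : ∀ i, c i • v i = (maximalIdeal L).toCotangent (l i • ⟨_, hfL i⟩) := by
      intro i
      rw [map_smul, ← hl i]
      rfl
    rw [Finset.sum_congr rfl fun i _ => h1 i, ← map_sum, Ideal.toCotangent_eq_zero]
    simpa using h0
  have h1 := LinearMap.finrank_range_add_finrank_ker Φ
  have h2 := LinearMap.finrank_range_add_finrank_ker M.vecMulLinear
  have h3 := Submodule.finrank_mono hker
  rw [hsurj, finrank_top] at h1
  have h4 : M.rank = Module.finrank P.ResidueField (LinearMap.range M.vecMulLinear) := by
    rw [← Matrix.rank_transpose, Matrix.rank, ← Matrix.mulVecLin_transpose M]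
  rw [height_eq_finrank_cotangentSpace]
  change ((Module.finrank P.ResidueField (CotangentSpace L) : ℕ) : ℕ∞) ≤ (M.rank : ℕ∞)
  exact_mod_cast (by omega : Module.finrank P.ResidueField (CotangentSpace L) ≤ M.rank)

end Jacobian

end ToricPullback

/-! ### Relations among the rays, and the identities satisfied by α and dα. -/

namespace ToricPullback

open MvPolynomial

variable {m : ℕ}

/-! ### The rays of a fan -/

section Rays

/-- The determinant of two vectors of `ℤ²`. -/
def det2 (v w : Fin 2 → ℤ) : ℤ := v 0 * w 1 - v 1 * w 0

theorem eq_or_eq_neg_of_det2_eq_zero {v w : Fin 2 → ℤ} (hv : IsCoprime (v 0) (v 1))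
    (hw : IsCoprime (w 0) (w 1)) (h : det2 v w = 0) : w = v ∨ w = -v := by
  obtain ⟨a, b, hab⟩ := hv
  obtain ⟨c, d, hcd⟩ := hw
  unfold det2 at h
  have h0 : w 0 = (a * w 0 + b * w 1) * v 0 := by linear_combination (-w 0) * hab - b * h
  have h1 : w 1 = (a * w 0 + b * w 1) * v 1 := by linear_combination (-w 1) * hab + a * h
  have hu : IsUnit (a * w 0 + b * w 1) := IsUnit.of_mul_eq_one (c * v 0 + d * v 1) (by
    linear_combination hcd - c * h0 - d * h1)
  rcases Int.isUnit_iff.1 hu with e | e <;> rw [e] at h0 h1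
  · left; ext k; fin_cases k <;> simp [h0, h1]
  · right; ext k; fin_cases k <;> simp [h0, h1]

/-- Two equal rays with different indices would lie in the cone of {i} ∩ {j} = ∅, which is 0,
against primitivity. -/
theorem CompleteFan.ray_ne (Δ : CompleteFan m) {i j : Fin m} (hij : i ≠ j) :
    Δ.ray i ≠ Δ.ray j := by
  intro h
  have hin : ∀ l, Δ.ray l = Δ.ray i →
      (fun k => (Δ.ray i k : ℝ)) ∈ coneOf Δ.ray {l} := fun l hl =>
    ⟨fun _ => 1, fun _ => zero_le_one, fun k => by simp [hl]⟩
  have h1 : (fun k => (Δ.ray i k : ℝ)) ∈ coneOf Δ.ray ({i} ∩ {j}) := by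
    rw [← Δ.inter _ (Δ.ray_mem i) _ (Δ.ray_mem j)]
    exact ⟨hin i rfl, hin j h.symm⟩
  rw [Finset.singleton_inter_of_notMem (by simpa using hij)] at h1
  obtain ⟨c, _, hc⟩ := h1
  obtain ⟨a, b, hab⟩ := Δ.primitive i
  have e0 := hc 0
  have e1 := hc 1
  simp only [Finset.sum_empty, Int.cast_eq_zero] at e0 e1
  rw [e0, e1] at hab
  simp at hab

theorem CompleteFan.ray_eq_neg (Δ : CompleteFan m) {i j : Fin m} (hij : i ≠ j)
    (h : det2 (Δ.ray i) (Δ.ray j) = 0) : Δ.ray j = -Δ.ray i :=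
  (eq_or_eq_neg_of_det2_eq_zero (Δ.primitive i) (Δ.primitive j) h).resolve_left
    (Δ.ray_ne hij).symm

/-- The relation among three rays given by Cramer's rule. -/
def CompleteFan.tripleRelation (Δ : CompleteFan m) (i j k : Fin m) : Fin m → ℤ :=
  Pi.single i (det2 (Δ.ray j) (Δ.ray k)) + Pi.single j (det2 (Δ.ray k) (Δ.ray i)) +
    Pi.single k (det2 (Δ.ray i) (Δ.ray j))

theorem sum_single_mul {A : Type*} [CommRing A] (φ : ℤ →+* A) (x y z : ℤ) (i j k : Fin m)
    (f : Fin m → A) :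
    ∑ l, φ ((Pi.single i x + Pi.single j y + Pi.single k z : Fin m → ℤ) l) * f l =
      φ x * f i + φ y * f j + φ z * f k := by
  simp only [Pi.add_apply, map_add, add_mul, Finset.sum_add_distrib]
  congr 1
  · congr 1
    · rw [Finset.sum_eq_single i (fun l _ hl => by simp [hl]) (by simp)]; simp
    · rw [Finset.sum_eq_single j (fun l _ hl => by simp [hl]) (by simp)]; simp
  · rw [Finset.sum_eq_single k (fun l _ hl => by simp [hl]) (by simp)]; simp

theorem CompleteFan.isRelation_tripleRelation (Δ : CompleteFan m) (i j k : Fin m) :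
    Δ.IsRelation (Δ.tripleRelation i j k) := by
  intro l
  have := sum_single_mul (RingHom.id ℤ) (det2 (Δ.ray j) (Δ.ray k)) (det2 (Δ.ray k) (Δ.ray i))
    (det2 (Δ.ray i) (Δ.ray j)) i j k (fun p => Δ.ray p l)
  simp only [RingHom.id_apply] at this
  rw [tripleRelation, this]
  unfold det2
  fin_cases l <;> simp <;> ring

/-- A ray has at most one opposite ray. -/
theorem CompleteFan.exists_det2_ne_zero (Δ : CompleteFan m) {i j k : Fin m} (hij : i ≠ j)
    (hjk : j ≠ k) (hik : i ≠ k) : det2 (Δ.ray i) (Δ.ray j) ≠ 0 ∨ det2 (Δ.ray i) (Δ.ray k) ≠ 0 := by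
  by_contra! h
  exact Δ.ray_ne hjk ((Δ.ray_eq_neg hij h.1).trans (Δ.ray_eq_neg hik h.2).symm)

theorem det2_swap (v w : Fin 2 → ℤ) : det2 v w = -det2 w v := by unfold det2; ring

end Rays

/-! ### The exterior derivative of a twisted form -/

section Forms

/-- The coefficient of `dzⱼ ∧ dzₖ` in `d(∑ Aᵢ dzᵢ)`. -/
noncomputable def curl {σ : Type*} (A : σ → MvPolynomial σ ℂ) (j k : σ) : MvPolynomial σ ℂ :=
  pderiv j (A k) - pderiv k (A j)

theorem curl_swap {σ : Type*} (A : σ → MvPolynomial σ ℂ) (j k : σ) :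
    curl A j k = -curl A k j := by unfold curl; ring

theorem pderiv_comm {σ : Type*} (i j : σ) (f : MvPolynomial σ ℂ) :
    pderiv i (pderiv j f) = pderiv j (pderiv i f) := by
  classical
  induction f using MvPolynomial.induction_on with
  | C a => simp
  | add p q hp hq => simp only [map_add, hp, hq]
  | mul_X p l hp =>
    simp only [Derivation.leibniz, map_add, pderiv_X, smul_eq_mul, hp]
    have : ∀ a b : σ, pderiv a (Pi.single (M := fun _ => MvPolynomial σ ℂ) b 1 l) = 0 := by
      intro a b
      by_cases h : l = b
      · subst h; simp
      · simp [h]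
    simp only [this]
    ring

theorem pderiv_curl_cyclic {σ : Type*} (A : σ → MvPolynomial σ ℂ) (i j k : σ) :
    pderiv i (curl A j k) + pderiv j (curl A k i) + pderiv k (curl A i j) = 0 := by
  simp only [curl, map_sub]
  rw [pderiv_comm i j, pderiv_comm j k, pderiv_comm i k]
  ring

variable {Δ : CompleteFan m} {D : Fin m → ℤ} {A : Fin m → MvPolynomial (Fin m) ℂ}

/-- Euler's formula for the weights a: pairing with a relation kills the principal part ⟨w, v_k⟩, so
all monomials of A_i have the same weight. -/
theorem IsTwistedForm.euler (hA : IsTwistedForm Δ D A) {a : Fin m → ℤ} (ha : Δ.IsRelation a)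
    (i : Fin m) : ∑ k, C (a k : ℂ) * X k * pderiv k (A i) =
      C ((∑ k, a k * D k - a i : ℤ) : ℂ) * A i := by
  conv_lhs => rw [(A i).as_sum]
  conv_rhs => rw [(A i).as_sum]
  simp only [map_sum, Finset.mul_sum]
  rw [Finset.sum_comm]
  refine Finset.sum_congr rfl fun u hu => ?_
  obtain ⟨w, hw⟩ := hA.homogeneous i u hu
  have hdeg : ∑ k, a k * (u k : ℤ) = ∑ k, a k * D k - a i := by
    have h1 : ∀ k, a k * (u k : ℤ) = a k * D k - (if k = i then a k else 0) +
        (w 0 * (a k * Δ.ray k 0) + w 1 * (a k * Δ.ray k 1)) := by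
      intro k
      have h2 := hw k
      rw [Fin.sum_univ_two] at h2
      have h3 : (if k = i then a k else 0) = a k * (if k = i then 1 else 0) := by split_ifs <;> simp
      rw [h3]
      linear_combination (a k) * h2
    rw [Finset.sum_congr rfl fun k _ => h1 k, Finset.sum_add_distrib, Finset.sum_sub_distrib,
      Finset.sum_add_distrib, ← Finset.mul_sum, ← Finset.mul_sum, ha 0, ha 1]
    simp
  have h4 : ∀ k, C (a k : ℂ) * X k * pderiv k (monomial u (coeff u (A i))) =
      C ((a k * (u k : ℤ) : ℤ) : ℂ) * monomial u (coeff u (A i)) := by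
    intro k
    rw [mul_assoc, X_mul_pderiv_monomial, nsmul_eq_mul]
    push_cast
    rw [map_mul]
    simp [mul_assoc]
  rw [Finset.sum_congr rfl fun k _ => h4 k, ← Finset.sum_mul, ← map_sum, ← hdeg]
  push_cast
  rfl

theorem IsTwistedForm.pderiv_descent (hA : IsTwistedForm Δ D A) {a : Fin m → ℤ}
    (ha : Δ.IsRelation a) (j : Fin m) :
    ∑ i, C (a i : ℂ) * X i * pderiv j (A i) = -(C (a j : ℂ) * A j) := by
  classical
  have h := congrArg (pderiv j) (hA.descent a ha)
  simp only [map_sum, Derivation.leibniz, pderiv_C, smul_eq_mul, pderiv_X,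
    map_zero, Finset.sum_add_distrib] at h
  rw [Finset.sum_eq_single j (f := fun x => A x * _) (fun l _ hl => by simp [hl])
    (by simp)] at h
  simp only [Pi.single_eq_same, mul_one] at h
  linear_combination h

/-- The contraction of `dα` with a radial vector field is a multiple of `α`. -/
theorem IsTwistedForm.contract_curl (hA : IsTwistedForm Δ D A) {a : Fin m → ℤ}
    (ha : Δ.IsRelation a) (k : Fin m) :
    ∑ j, C (a j : ℂ) * X j * curl A j k = C ((∑ k, a k * D k : ℤ) : ℂ) * A k := by
  have h1 := hA.euler ha k
  have h2 := hA.pderiv_descent ha k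
  simp only [curl, mul_sub, Finset.sum_sub_distrib, h1, h2]
  push_cast
  simp only [map_sub]
  ring

/-- `α ∧ dα = 0`. -/
theorem IsTwistedForm.integrable (hA : IsTwistedForm Δ D A) (i j k : Fin m) :
    A i * curl A j k + A j * curl A k i + A k * curl A i j = 0 := by
  let Θ : Fin m → Fin m → Fin m → MvPolynomial (Fin m) ℂ := fun i j k =>
    A i * curl A j k + A j * curl A k i + A k * curl A i j
  have hcyc : ∀ i j k, Θ i j k = Θ j k i := fun i j k => by simp only [Θ]; ring
  have hself : ∀ l, curl A l l = 0 := fun l => by simp [curl]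
  have hdeg : ∀ i j, Θ i i j = 0 := fun i j => by
    simp only [Θ, hself, curl_swap A j i]; ring
  -- For a radial field R, i_R α = 0 and i_R dα is a multiple of α, so i_R(α ∧ dα) = 0.
  have hcontr : ∀ a, Δ.IsRelation a → ∀ p q, ∑ l, C (a l : ℂ) * X l * Θ l p q = 0 := by
    intro a ha p q
    have e1 : ∀ l, C (a l : ℂ) * X l * Θ l p q = C (a l : ℂ) * X l * A l * curl A p q -
        A p * (C (a l : ℂ) * X l * curl A l q) + A q * (C (a l : ℂ) * X l * curl A l p) := by
      intro l
      simp only [Θ, curl_swap A q l]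
      ring
    rw [Finset.sum_congr rfl fun l _ => e1 l, Finset.sum_add_distrib, Finset.sum_sub_distrib,
      ← Finset.sum_mul, ← Finset.mul_sum, ← Finset.mul_sum, hA.descent a ha,
      hA.contract_curl ha, hA.contract_curl ha]
    ring
  -- With the relation supported on i, j, k, alternation leaves only det(v_j, v_k) z_i Θ_ijk.
  have hmain : ∀ i j k, det2 (Δ.ray j) (Δ.ray k) ≠ 0 → Θ i j k = 0 := by
    intro i j k hd
    have h1 := hcontr _ (Δ.isRelation_tripleRelation i j k) j k
    have h2 := sum_single_mul (Int.castRingHom (MvPolynomial (Fin m) ℂ))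
      (det2 (Δ.ray j) (Δ.ray k)) (det2 (Δ.ray k) (Δ.ray i))
      (det2 (Δ.ray i) (Δ.ray j)) i j k (fun l => X l * Θ l j k)
    simp only [eq_intCast] at h2
    simp only [CompleteFan.tripleRelation, mul_assoc, map_intCast] at h1
    rw [h2, hdeg, show Θ k j k = 0 by rw [← hcyc, hdeg]] at h1
    simp only [mul_zero, add_zero, mul_eq_zero, Int.cast_eq_zero, hd, false_or,
      X_ne_zero] at h1
    exact h1
  change Θ i j k = 0
  by_cases hij : i = j
  · subst hij; exact hdeg _ _
  by_cases hjk : j = k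
  · subst hjk; rw [hcyc, hdeg]
  by_cases hik : i = k
  · subst hik; rw [hcyc, hcyc, hdeg]
  rcases Δ.exists_det2_ne_zero hij hjk hik with h | h
  · rw [← hcyc]; exact hmain _ _ _ h
  · rw [hcyc]; exact hmain _ _ _ (by rw [det2_swap]; exact neg_ne_zero.2 h)

/-- `dα ∧ dα = 0`. -/
theorem IsTwistedForm.curl_plucker (hA : IsTwistedForm Δ D A) (i j k l : Fin m) :
    curl A i j * curl A k l - curl A i k * curl A j l + curl A i l * curl A j k = 0 := by
  -- dα ∧ dα = d(α ∧ dα): the alternating sum of these derivatives is twice the Plücker expression,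
  -- the undifferentiated A's being killed by d(dα) = 0.
  have key : ∀ i j k l, pderiv l (A i) * curl A j k + pderiv l (A j) * curl A k i +
      pderiv l (A k) * curl A i j + (A i * pderiv l (curl A j k) + A j * pderiv l (curl A k i) +
      A k * pderiv l (curl A i j)) = 0 := by
    intro i j k l
    have h := congrArg (pderiv l) (hA.integrable i j k)
    simp only [map_add, Derivation.leibniz, smul_eq_mul, map_zero] at h
    linear_combination h
  have h1 := key i j k l
  have h2 := key j k l i
  have h3 := key k l i j
  have h4 := key l i j k
  have c1 := pderiv_curl_cyclic A j k l
  have c2 := pderiv_curl_cyclic A k l i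
  have c3 := pderiv_curl_cyclic A l i j
  have c4 := pderiv_curl_cyclic A i j k
  have two : (2 : MvPolynomial (Fin m) ℂ) *
      (curl A i j * curl A k l - curl A i k * curl A j l + curl A i l * curl A j k) = 0 := by
    simp only [curl, map_sub] at h1 h2 h3 h4 c1 c2 c3 c4 ⊢
    linear_combination -h1 + h2 - h3 + h4 + A i * c1 - A j * c2 + A k * c3 - A l * c4
  exact (mul_eq_zero.1 two).resolve_left two_ne_zero

end Forms

end ToricPullback

namespace ToricPullback

open MvPolynomial

variable {m : ℕ}

/-! ### Rank bound for the symmetric Jacobian matrix. -/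

section LinearAlgebra

variable {κ : Type*} [Field κ]

theorem rank_le_two_of_rows {ι σ : Type*} [Fintype ι] [Fintype σ] (M : Matrix ι σ κ) (r s : σ → κ)
    (h : ∀ i, ∃ a b : κ, ∀ j, M i j = a * r j + b * s j) : M.rank ≤ 2 := by
  classical
  rw [Matrix.rank_eq_finrank_span_row]
  have hle : Submodule.span κ (Set.range M.row) ≤
      Submodule.span κ (({r, s} : Finset _) : Set _) := by
    rw [Submodule.span_le]
    rintro _ ⟨i, rfl⟩
    obtain ⟨a, b, hab⟩ := h i
    have : M.row i = a • r + b • s := by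
      ext j
      simpa [Matrix.row] using hab j
    rw [this]
    exact add_mem (Submodule.smul_mem _ _ (Submodule.subset_span (by simp)))
      (Submodule.smul_mem _ _ (Submodule.subset_span (by simp)))
  exact (Submodule.finrank_mono hle).trans
    ((finrank_span_finset_le_card _).trans (Finset.card_le_two))

theorem rank_le_one_of_rows {ι σ : Type*} [Fintype ι] [Fintype σ] (M : Matrix ι σ κ) (r : σ → κ)
    (h : ∀ i, ∃ a : κ, ∀ j, M i j = a * r j) : M.rank ≤ 1 := by
  classical
  rw [Matrix.rank_eq_finrank_span_row]
  have hle : Submodule.span κ (Set.range M.row) ≤ Submodule.span κ (({r} : Finset _) : Set _) := by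
    rw [Submodule.span_le]
    rintro _ ⟨i, rfl⟩
    obtain ⟨a, ha⟩ := h i
    have : M.row i = a • r := by
      ext j
      simpa [Matrix.row] using ha j
    rw [this]
    exact Submodule.smul_mem _ _ (Submodule.subset_span (by simp))
  exact (Submodule.finrank_mono hle).trans
    ((finrank_span_finset_le_card _).trans (by simp))

theorem tripleRelation_apply (Δ : CompleteFan m) {i j k : Fin m} (hij : i ≠ j) (hjk : j ≠ k)
    (hik : i ≠ k) :
    Δ.tripleRelation i j k i = det2 (Δ.ray j) (Δ.ray k) ∧
    Δ.tripleRelation i j k j = det2 (Δ.ray k) (Δ.ray i) ∧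
    Δ.tripleRelation i j k k = det2 (Δ.ray i) (Δ.ray j) ∧
    ∀ l, l ≠ i → l ≠ j → l ≠ k → Δ.tripleRelation i j k l = 0 := by
  refine ⟨?_, ?_, ?_, fun l h1 h2 h3 => ?_⟩ <;>
    simp [CompleteFan.tripleRelation, *, hij.symm, hjk.symm, hik.symm]

/-- The Hessian of a potential transverse to a component of `Sing(α)` has rank at most two. -/
theorem rank_symmetric_le_two [CharZero κ] (Δ : CompleteFan m) (z : Fin m → κ)
    (M : Matrix (Fin m) (Fin m) κ) (hsym : ∀ i j, M i j = M j i)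
    (hE : ∀ a, Δ.IsRelation a → ∀ j, ∑ i, (a i : κ) * (z i * M i j) = 0)
    (hS : ∀ a, Δ.IsRelation a → (∀ i, a i ≠ 0 → z i = 0) →
      ∀ j k, ((a j : κ) + a k) * M j k = 0)
    (hN : ∀ c : Fin m → κ, (∀ j, ∑ k, M j k * c k = 0) → ∀ i, z i = 0 → c i = 0) :
    M.rank ≤ 2 := by
  have hS' : ∀ a, Δ.IsRelation a → (∀ i, a i ≠ 0 → z i = 0) →
      ∀ j k, a j + a k ≠ 0 → M j k = 0 := by
    intro a h1 h2 j k h3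
    refine (mul_eq_zero.1 (hS a h1 h2 j k)).resolve_left ?_
    exact_mod_cast h3
  -- A zero row would put the basis vector e_i in the kernel, against `hN`.
  have hcol : ∀ i, z i = 0 → ¬ ∀ l, M i l = 0 := by
    intro i hi h
    have := hN (Pi.single i 1) (fun j => by
      rw [Finset.sum_eq_single i (fun k _ hk => by simp [hk]) (by simp)]
      simp [hsym j i, h]) i hi
    simp at this
  have hsupp : ∀ i j k, i ≠ j → j ≠ k → i ≠ k → z i = 0 → z j = 0 → z k = 0 →
      ∀ l, Δ.tripleRelation i j k l ≠ 0 → z l = 0 := by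
    intro i j k hij hjk hik hi hj hk l hl
    by_contra hz
    refine hl ((tripleRelation_apply Δ hij hjk hik).2.2.2 l ?_ ?_ ?_) <;>
      (rintro rfl; exact hz ‹_›)
  -- two of three vanishing coordinates are not opposite
  have hA0 : ∀ i j k, i ≠ j → j ≠ k → i ≠ k → z i = 0 → z j = 0 → z k = 0 →
      det2 (Δ.ray i) (Δ.ray j) ≠ 0 := by
    intro i j k hij hjk hik hi hj hk h0
    obtain ⟨e1, e2, e3, e4⟩ := tripleRelation_apply Δ hij hjk hik
    have hneg := Δ.ray_eq_neg hij h0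
    have hα : det2 (Δ.ray i) (Δ.ray k) ≠ 0 :=
      (Δ.exists_det2_ne_zero hij hjk hik).resolve_left (by simpa using h0)
    have e1' : Δ.tripleRelation i j k i = -det2 (Δ.ray i) (Δ.ray k) := by
      rw [e1, hneg]; simp [det2]; ring
    have e2' : Δ.tripleRelation i j k j = -det2 (Δ.ray i) (Δ.ray k) := by
      rw [e2, det2_swap]
    rw [h0] at e3
    -- For opposite v_i, v_j the relation has a_i = a_j ≠ 0 and all other entries zero, so a_i + a_l
    -- never vanishes and row i would be zero.
    refine hcol i hi fun l => hS' _ (Δ.isRelation_tripleRelation i j k)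
      (hsupp i j k hij hjk hik hi hj hk) i l ?_
    rw [e1']
    by_cases h1 : l = i
    · subst h1; rw [e1']; omega
    by_cases h2 : l = j
    · subst h2; rw [e2']; omega
    by_cases h3 : l = k
    · subst h3; rw [e3]; omega
    · rw [e4 l h1 h2 h3]; omega
  -- Two rows supported in one common column are proportional; the proportion is a kernel vector
  -- supported on i and j.
  have hA1 : ∀ i j k, i ≠ j → j ≠ k → i ≠ k → z i = 0 → z j = 0 →
      (∀ l, l ≠ k → M i l = 0) → ¬ (∀ l, l ≠ k → M j l = 0) := by
    intro i j k hij hjk hik hi hj h1 h2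
    have h3 := hN (Pi.single i (M j k) - Pi.single j (M i k)) (fun l => by
      simp only [Pi.sub_apply, mul_sub, Finset.sum_sub_distrib]
      rw [Finset.sum_eq_single i (fun k _ hk => by simp [hk]) (by simp),
        Finset.sum_eq_single j (fun k _ hk => by simp [hk]) (by simp)]
      by_cases hl : l = k
      · subst hl; simp [hsym l i, hsym l j, mul_comm]
      · simp [hsym l i, hsym l j, h1 l hl, h2 l hl]) j hj
    refine hcol i hi fun l => ?_
    by_cases hl : l = k
    · subst hl; simpa [hij.symm, hij] using h3
    · exact h1 l hl
  -- Three coordinates cannot vanish: rows i, j, k would live in columns i, j, k with zero diagonal.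
  -- The three pairwise sums of the nonzero numbers a_i, a_j, a_k are not all zero, so one
  -- off-diagonal entry vanishes too and `hA1` applies.
  have hA : ∀ i j k, i ≠ j → j ≠ k → i ≠ k → z i = 0 → z j = 0 → z k = 0 → False := by
    intro i j k hij hjk hik hi hj hk
    obtain ⟨e1, e2, e3, e4⟩ := tripleRelation_apply Δ hij hjk hik
    have n1 : det2 (Δ.ray j) (Δ.ray k) ≠ 0 := hA0 j k i hjk hik.symm hij.symm hj hk hi
    have n2 : det2 (Δ.ray k) (Δ.ray i) ≠ 0 := hA0 k i j hik.symm hij hjk.symm hk hi hj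
    have n3 := hA0 i j k hij hjk hik hi hj hk
    rw [← e1] at n1
    rw [← e2] at n2
    rw [← e3] at n3
    have hrow := hS' _ (Δ.isRelation_tripleRelation i j k)
      (hsupp i j k hij hjk hik hi hj hk)
    set a := Δ.tripleRelation i j k
    have h1 : ∀ p, a p ≠ 0 → ∀ l, l ≠ i → l ≠ j → l ≠ k → M p l = 0 := fun p hp l l1 l2 l3 =>
      hrow p l (by rw [e4 l l1 l2 l3]; simpa using hp)
    have h2 : ∀ p, a p ≠ 0 → M p p = 0 := fun p hp => hrow p p (by omega)
    have hoff : a i + a j ≠ 0 ∨ a j + a k ≠ 0 ∨ a i + a k ≠ 0 := by omega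
    rcases hoff with h | h | h
    · have h0 := hrow i j h
      refine hA1 i j k hij hjk hik hi hj (fun l hl => ?_) (fun l hl => ?_)
      · by_cases l1 : l = i
        · rw [l1]; exact h2 _ n1
        by_cases l2 : l = j
        · rw [l2]; exact h0
        exact h1 i n1 l l1 l2 hl
      · by_cases l1 : l = i
        · rw [l1, hsym]; exact h0
        by_cases l2 : l = j
        · rw [l2]; exact h2 _ n2
        exact h1 j n2 l l1 l2 hl
    · have h0 := hrow j k h
      refine hA1 j k i hjk hik.symm hij.symm hj hk (fun l hl => ?_) (fun l hl => ?_)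
      · by_cases l1 : l = j
        · rw [l1]; exact h2 _ n2
        by_cases l2 : l = k
        · rw [l2]; exact h0
        exact h1 j n2 l hl l1 l2
      · by_cases l1 : l = j
        · rw [l1, hsym]; exact h0
        by_cases l2 : l = k
        · rw [l2]; exact h2 _ n3
        exact h1 k n3 l hl l1 l2
    · have h0 := hrow i k h
      refine hA1 i k j hik hjk.symm hij hi hk (fun l hl => ?_) (fun l hl => ?_)
      · by_cases l1 : l = i
        · rw [l1]; exact h2 _ n1
        by_cases l2 : l = k
        · rw [l2]; exact h0
        exact h1 i n1 l l1 hl l2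
      · by_cases l1 : l = i
        · rw [l1, hsym]; exact h0
        by_cases l2 : l = k
        · rw [l2]; exact h2 _ n3
        exact h1 k n3 l l1 hl l2
  -- Opposite rays give the relation e_i + e_j, for which a_i + a_l > 0 for every l, so row i would
  -- be zero.
  have hB1 : ∀ i j, i ≠ j → z i = 0 → z j = 0 → det2 (Δ.ray i) (Δ.ray j) ≠ 0 := by
    intro i j hij hi hj h0
    have hneg := Δ.ray_eq_neg hij h0
    have hrel : Δ.IsRelation (Pi.single i 1 + Pi.single j 1) := by
      intro k
      simp only [Pi.add_apply, add_mul, Finset.sum_add_distrib]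
      rw [Finset.sum_eq_single i (fun k _ hk => by simp [hk]) (by simp),
        Finset.sum_eq_single j (fun k _ hk => by simp [hk]) (by simp), hneg]
      simp
    refine hcol i hi fun l => hS' _ hrel (fun p hp => ?_) i l ?_
    · by_contra hz
      apply hp
      have h1 : p ≠ i := by rintro rfl; exact hz hi
      have h2 : p ≠ j := by rintro rfl; exact hz hj
      simp [h1, h2]
    · by_cases h1 : l = i
      · subst h1; simp [hij]
      · by_cases h2 : l = j
        · subst h2; simp [hij, h1]
        · simp [hij, h1, h2]
  by_contra hrank
  have hm : 2 < m := by
    have := M.rank_le_card_width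
    rw [Fintype.card_fin] at this
    omega
  have hother : ∀ i : Fin m, ∃ q, q ≠ i ∧ det2 (Δ.ray i) (Δ.ray q) ≠ 0 := by
    intro i
    obtain ⟨j, hj⟩ : ∃ j : Fin m, j ∉ ({i} : Finset (Fin m)) := by
      by_contra! h
      have := Finset.card_le_card (fun x (_ : x ∈ Finset.univ) => h x)
      simp at this
      omega
    obtain ⟨k, hk⟩ : ∃ k : Fin m, k ∉ ({i, j} : Finset (Fin m)) := by
      by_contra! h
      have := (Finset.card_le_card (fun x (_ : x ∈ Finset.univ) => h x)).trans Finset.card_le_two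
      simp at this
      omega
    simp only [Finset.mem_insert, Finset.mem_singleton, not_or] at hj hk
    rcases Δ.exists_det2_ne_zero (Ne.symm hj) (Ne.symm hk.2) (Ne.symm hk.1) with h | h
    · exact ⟨j, hj, h⟩
    · exact ⟨k, hk.1, h⟩
  -- At most two coordinates vanish, and they can be placed among two independent rays p, q. For any
  -- other l, `hE` applied to the Cramer relation of p, q, l can be divided by det(v_p, v_q) z_l, so
  -- rows p and q span all rows.
  obtain ⟨p, q, hpq, hdet, hz⟩ : ∃ p q, p ≠ q ∧ det2 (Δ.ray p) (Δ.ray q) ≠ 0 ∧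
      ∀ l, l ≠ p → l ≠ q → z l ≠ 0 := by
    by_cases h2 : ∃ i j, i ≠ j ∧ z i = 0 ∧ z j = 0
    · obtain ⟨i, j, hij, hi, hj⟩ := h2
      exact ⟨i, j, hij, hB1 i j hij hi hj, fun l h1 h2 h3 =>
        hA i j l hij (Ne.symm h2) (Ne.symm h1) hi hj h3⟩
    · push Not at h2
      by_cases h1 : ∃ i, z i = 0
      · obtain ⟨i, hi⟩ := h1
        obtain ⟨q, hq, hd⟩ := hother i
        exact ⟨i, q, hq.symm, hd, fun l hl _ => h2 i l hl.symm hi⟩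
      · push Not at h1
        obtain ⟨q, hq, hd⟩ := hother ⟨0, by omega⟩
        exact ⟨_, q, hq.symm, hd, fun l _ _ => h1 l⟩
  refine hrank (rank_le_two_of_rows M (M p) (M q) fun l => ?_)
  by_cases hlp : l = p
  · exact ⟨1, 0, fun j => by simp [hlp]⟩
  by_cases hlq : l = q
  · exact ⟨0, 1, fun j => by simp [hlq]⟩
  have hdet' : ((det2 (Δ.ray p) (Δ.ray q) : ℤ) : κ) ≠ 0 := by exact_mod_cast hdet
  have hzl := hz l hlp hlq
  refine ⟨-((det2 (Δ.ray q) (Δ.ray l) : ℤ) : κ) * z p /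
      (((det2 (Δ.ray p) (Δ.ray q) : ℤ) : κ) * z l),
    -((det2 (Δ.ray l) (Δ.ray p) : ℤ) : κ) * z q /
      (((det2 (Δ.ray p) (Δ.ray q) : ℤ) : κ) * z l), fun j => ?_⟩
  have h1 := hE _ (Δ.isRelation_tripleRelation p q l) j
  have h2 := sum_single_mul (Int.castRingHom κ)
    (det2 (Δ.ray q) (Δ.ray l)) (det2 (Δ.ray l) (Δ.ray p))
    (det2 (Δ.ray p) (Δ.ray q)) p q l (fun i => z i * M i j)
  simp only [eq_intCast] at h2
  rw [CompleteFan.tripleRelation, h2] at h1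
  field_simp
  linear_combination h1

end LinearAlgebra

end ToricPullback

namespace ToricPullback

open MvPolynomial

/-! ### Localization at minimal primes. -/

section Local

theorem algebraMap_mem_map_iff {R : Type*} [CommRing R] (I P : Ideal R) [P.IsPrime] (x : R) :
    algebraMap R (Localization.AtPrime P) x ∈ I.map (algebraMap R (Localization.AtPrime P)) ↔
      ∃ s ∉ P, s * x ∈ I :=
  IsLocalization.algebraMap_mem_map_algebraMap_iff P.primeCompl _ I x

theorem exists_mul_pow_mem {R : Type*} [CommRing R] {W Q : Ideal R} (hQ : Q ∈ W.minimalPrimes)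
    {q : R} (hq : q ∈ Q) : ∃ s ∉ Q, ∃ k, s * q ^ k ∈ W := by
  have hprime : Q.IsPrime := Ideal.IsMinimalPrime.isPrime hQ
  have h1 : algebraMap R (Localization.AtPrime Q) q ∈
      (W.map (algebraMap R (Localization.AtPrime Q))).radical := by
    rw [IsLocalization.AtPrime.radical_map_of_mem_minimalPrimes _ Q W hQ]
    exact Ideal.mem_map_of_mem _ hq
  obtain ⟨k, hk⟩ := h1
  rw [← map_pow, algebraMap_mem_map_iff] at hk
  obtain ⟨s, hs, h2⟩ := hk
  exact ⟨s, hs, k, h2⟩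

theorem exists_notMem_mul_mem {R : Type*} [CommRing R] {I P : Ideal R} (hI : I.IsRadical)
    (hP : P ∈ I.minimalPrimes) {q : R} (hq : q ∈ P) : ∃ s ∉ P, s * q ∈ I := by
  obtain ⟨s, hs, n, h⟩ := exists_mul_pow_mem hP hq
  refine ⟨s, hs, hI ⟨n + 1, ?_⟩⟩
  rw [show (s * q) ^ (n + 1) = (s ^ n * q) * (s * q ^ n) by ring]
  exact Ideal.mul_mem_left _ _ h

variable {σ : Type*} [Fintype σ]

/-- A prime generated locally by two polynomials with dependent gradients has height at most
one. -/
theorem height_le_one_of_minors_mem (P : Ideal (MvPolynomial σ ℂ)) [P.IsPrime]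
    {f g : MvPolynomial σ ℂ} (hf : f ∈ P) (hg : g ∈ P)
    (hgen : ∀ q ∈ P, ∃ s ∉ P, s * q ∈ Ideal.span {f, g})
    (hminor : ∀ j k, pderiv j f * pderiv k g - pderiv k f * pderiv j g ∈ P) : P.height ≤ 1 := by
  refine (height_le_rank_jacobian P ![f, g] (fun i => by fin_cases i <;> simpa) ?_).trans ?_
  · intro q hq
    obtain ⟨s, hs, h⟩ := hgen q hq
    exact ⟨s, hs, by rwa [Matrix.range_cons_cons_empty]⟩
  let ρ := algebraMap (MvPolynomial σ ℂ) P.ResidueField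
  have hρ : ∀ j k, ρ (pderiv j f) * ρ (pderiv k g) = ρ (pderiv k f) * ρ (pderiv j g) := by
    intro j k
    have := (Ideal.algebraMap_residueField_eq_zero (I := P)).2 (hminor j k)
    rwa [map_sub, map_mul, map_mul, sub_eq_zero] at this
  have hrank : (Matrix.of fun i j => ρ (pderiv j (![f, g] i))).rank ≤ 1 := by
    by_cases h0 : ∃ j, ρ (pderiv j f) ≠ 0
    · obtain ⟨j, hj⟩ := h0
      refine rank_le_one_of_rows _ (fun k => ρ (pderiv k f)) fun i => ?_
      fin_cases i
      · exact ⟨1, fun k => by simp⟩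
      · refine ⟨ρ (pderiv j g) / ρ (pderiv j f), fun k => ?_⟩
        have := hρ j k
        simp only [Matrix.of_apply]
        simp
        field_simp
        linear_combination this
    · push Not at h0
      refine rank_le_one_of_rows _ (fun k => ρ (pderiv k g)) fun i => ?_
      fin_cases i
      · exact ⟨0, fun k => by simp [h0]⟩
      · exact ⟨1, fun k => by simp⟩
  exact_mod_cast hrank

end Local

/-! ### The generic structure of Sing(α). -/

section SingularLocus

variable {m : ℕ} {Δ : CompleteFan m} {D : Fin m → ℤ} {A : Fin m → MvPolynomial (Fin m) ℂ}

theorem mem_singularIdeal {σ : Type*} (A : σ → MvPolynomial σ ℂ) (i : σ) : A i ∈ singularIdeal A :=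
  Ideal.subset_span ⟨i, rfl⟩

/-- Every component of `Sing(α)` is of Kupka type. -/
theorem IsTwistedForm.exists_curl_notMem (hA : IsTwistedForm Δ D A)
    (hrad : (singularIdeal A).IsRadical) (hd : 3 ≤ (dIdeal A).height)
    {P : Ideal (MvPolynomial (Fin m) ℂ)} (hP : P ∈ (singularIdeal A).minimalPrimes) :
    ∃ a b, curl A a b ∉ P := by
  by_contra! hcurl
  have : P.IsPrime := Ideal.IsMinimalPrime.isPrime hP
  have hJP : singularIdeal A ≤ P := Ideal.IsMinimalPrime.le hP
  have hle : dIdeal A ≤ P := Ideal.span_le.2 (by rintro _ ⟨⟨a, b⟩, rfl⟩; exact hcurl a b)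
  have hAP : ∀ i, A i ∈ P := fun i => hJP (mem_singularIdeal A i)
  have hloc : ∀ q ∈ P, ∃ s ∉ P, s * q ∈ Ideal.span (Set.range A) := fun q hq =>
    exists_notMem_mul_mem hrad hP hq
  have hrank := height_le_rank_jacobian P A hAP hloc
  let ρ := algebraMap (MvPolynomial (Fin m) ℂ) P.ResidueField
  have hρ : ∀ x, ρ x = 0 ↔ x ∈ P := fun x => Ideal.algebraMap_residueField_eq_zero
  have : CharZero P.ResidueField :=
    charZero_of_injective_algebraMap (algebraMap ℂ P.ResidueField).injective
  let M : Matrix (Fin m) (Fin m) P.ResidueField := Matrix.of fun i j => ρ (pderiv j (A i))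
  -- If dα vanishes along P, the Jacobian matrix is symmetric; a rank of at most 2 contradicts
  -- height P ≥ 3, as P contains 𝒞(dα).
  have hrank2 : M.rank ≤ 2 := by
    refine rank_symmetric_le_two Δ (fun i => ρ (X i)) M ?_ ?_ ?_ ?_
    · intro i j
      have := (hρ _).2 (hcurl j i)
      rw [curl, map_sub, sub_eq_zero] at this
      exact this
    · intro a ha j
      have := congrArg ρ (hA.pderiv_descent ha j)
      simp only [map_sum, map_mul, map_neg, (hρ _).2 (hAP j), mul_zero, neg_zero, map_intCast,
        mul_assoc] at this
      exact this
    -- Second derivative of the descent relation: the terms with second derivatives of A carry a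
    -- factor a_i z_i, which is zero along P.
    · intro a ha hsupp j k
      have := congrArg (pderiv k) (hA.pderiv_descent ha j)
      simp only [map_sum, Derivation.leibniz, map_neg, smul_eq_mul, pderiv_C, mul_zero, add_zero,
        pderiv_X] at this
      replace this := congrArg ρ this
      simp only [map_sum, map_neg, map_add, map_mul, map_intCast] at this
      have e : ∀ i, ρ (X i) * (a i : P.ResidueField) = 0 := by
        intro i
        by_cases h : a i = 0
        · simp [h]
        · rw [hsupp i h, zero_mul]
      have e2 : ∀ i, ρ (pderiv j (A i)) * ((a i : P.ResidueField) *
          ρ (Pi.single (M := fun _ => MvPolynomial (Fin m) ℂ) k 1 i)) =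
          if i = k then (a k : P.ResidueField) * M k j else 0 := by
        intro i
        by_cases h : i = k
        · subst h; simp [M, mul_comm]
        · simp [h]
      simp only [mul_comm (a _ : P.ResidueField) (ρ (X _)), e, zero_mul, zero_add, e2,
        Finset.sum_ite_eq', Finset.mem_univ, if_true] at this
      change ((a j : P.ResidueField) + a k) * M j k = 0
      have hs : M k j = M j k := by
        have := (hρ _).2 (hcurl j k)
        rw [curl, map_sub, sub_eq_zero] at this
        exact this
      rw [hs] at this
      have h3 : ρ (pderiv k (A j)) = M j k := rfl
      rw [h3] at this
      linear_combination this
    -- Near P the function z_i is a combination of the A_j, so its gradient e_i lies in the row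
    -- space of M.
    · intro c hc i hi
      obtain ⟨s, hs, hsi⟩ := hloc _ ((hρ _).1 hi)
      rw [Ideal.mem_span_range_iff_exists_fun] at hsi
      obtain ⟨h, hh⟩ := hsi
      have hk : ∀ k, ρ s * (if k = i then 1 else 0) = ∑ j, ρ (h j) * M j k := by
        intro k
        have := congrArg (fun f => ρ (pderiv k f)) hh
        simp only [map_sum, Derivation.leibniz, map_add, smul_eq_mul, map_mul, (hρ _).2 (hAP _),
          zero_mul, add_zero, hi, pderiv_X] at this
        refine Eq.trans ?_ this.symm
        congr 1
        by_cases e : k = i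
        · subst e; simp
        · simp [e, Ne.symm e]
      have h1 : ρ s * c i = 0 := by
        calc ρ s * c i = ∑ k, (ρ s * (if k = i then 1 else 0)) * c k := by
              simp [Finset.sum_ite_eq']
          _ = ∑ j, ρ (h j) * ∑ k, M j k * c k := by
              simp only [hk, Finset.sum_mul, Finset.mul_sum]
              rw [Finset.sum_comm]
              simp only [mul_assoc]
          _ = 0 := by simp [hc]
      exact (mul_eq_zero.1 h1).resolve_left (fun h => hs ((hρ s).1 h))
  have h3 := (hd.trans (Ideal.height_mono hle)).trans hrank
  have : (3 : ℕ∞) ≤ (2 : ℕ) := h3.trans (by exact_mod_cast hrank2)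
  exact absurd this (by decide)

/-- Integrability solved for A_i: wherever (dα)_ab is invertible, A_a and A_b generate J(α). -/
theorem IsTwistedForm.curl_mul_mem_span_pair (hA : IsTwistedForm Δ D A) (a b i : Fin m) :
    curl A a b * A i = -curl A b i * A a + curl A a i * A b := by
  have h := hA.integrable i a b
  rw [curl_swap A i a] at h
  linear_combination h

/-- The derivative of integrability along z_a: modulo J(α), (dα)_ab dA_a is a combination of rows a
and b of dα. -/
theorem IsTwistedForm.curl_mul_pderiv_left (hA : IsTwistedForm Δ D A) (a b l : Fin m) :
    curl A a b * pderiv l (A a) - (-pderiv a (A a) * curl A b l + pderiv b (A a) * curl A a l) ∈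
      singularIdeal A := by
  have h := congrArg (pderiv a) (hA.integrable l a b)
  simp only [map_add, Derivation.leibniz, smul_eq_mul, map_zero] at h
  have e : curl A a b * pderiv l (A a) -
      (-pderiv a (A a) * curl A b l + pderiv b (A a) * curl A a l) =
      -pderiv a (curl A a b) * A l - pderiv a (curl A b l) * A a - pderiv a (curl A l a) * A b := by
    simp only [curl] at h ⊢
    linear_combination h
  rw [e]
  exact sub_mem (sub_mem (Ideal.mul_mem_left _ _ (mem_singularIdeal A l))
    (Ideal.mul_mem_left _ _ (mem_singularIdeal A a)))
    (Ideal.mul_mem_left _ _ (mem_singularIdeal A b))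

theorem IsTwistedForm.curl_mul_pderiv_right (hA : IsTwistedForm Δ D A) (a b l : Fin m) :
    curl A a b * pderiv l (A b) - (-pderiv a (A b) * curl A b l + pderiv b (A b) * curl A a l) ∈
      singularIdeal A := by
  have h := congrArg (pderiv b) (hA.integrable l a b)
  simp only [map_add, Derivation.leibniz, smul_eq_mul, map_zero] at h
  have e : curl A a b * pderiv l (A b) -
      (-pderiv a (A b) * curl A b l + pderiv b (A b) * curl A a l) =
      -pderiv b (curl A a b) * A l - pderiv b (curl A b l) * A a - pderiv b (curl A l a) * A b := by
    simp only [curl] at h ⊢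
    linear_combination h
  rw [e]
  exact sub_mem (sub_mem (Ideal.mul_mem_left _ _ (mem_singularIdeal A l))
    (Ideal.mul_mem_left _ _ (mem_singularIdeal A a)))
    (Ideal.mul_mem_left _ _ (mem_singularIdeal A b))

/-- Both gradients are combinations of the same two rows modulo J, so their minor is a determinant
times that of the rows; the Plücker relation `hp` rewrites the latter as s times a coefficient of
dα. -/
theorem minor_sub_mem_of_mem {R : Type*} [CommRing R] {J : Ideal R}
    {s x₁ x₂ y₁ y₂ pa pb qa qb ap bp aq bq pq : R}
    (h1 : s * pa - (-x₁ * bp + x₂ * ap) ∈ J) (h2 : s * qa - (-x₁ * bq + x₂ * aq) ∈ J)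
    (h3 : s * pb - (-y₁ * bp + y₂ * ap) ∈ J) (h4 : s * qb - (-y₁ * bq + y₂ * aq) ∈ J)
    (hp : s * pq - ap * bq + aq * bp = 0) :
    s ^ 2 * (pa * qb - qa * pb) - (x₁ * y₂ - x₂ * y₁) * s * pq ∈ J := by
  have e := sub_mem (add_mem (Ideal.mul_mem_right (s * qb) _ h1)
    (Ideal.mul_mem_left _ (-x₁ * bp + x₂ * ap) h4))
    (add_mem (Ideal.mul_mem_right (s * pb) _ h2) (Ideal.mul_mem_left _ (-x₁ * bq + x₂ * aq) h3))
  convert e using 1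
  linear_combination -(x₁ * y₂ - x₂ * y₁) * hp

/-- Makes dA_a ∧ dA_b a multiple of dα modulo J(α) wherever (dα)_ab is invertible; its pullback
links the vanishing of dω to dependent gradients. -/
theorem IsTwistedForm.minor_sub_curl_mem (hA : IsTwistedForm Δ D A) (a b p q : Fin m) :
    curl A a b ^ 2 * (pderiv p (A a) * pderiv q (A b) - pderiv q (A a) * pderiv p (A b)) -
      (pderiv a (A a) * pderiv b (A b) - pderiv b (A a) * pderiv a (A b)) * curl A a b *
        curl A p q ∈ singularIdeal A := by
  exact minor_sub_mem_of_mem (hA.curl_mul_pderiv_left a b p) (hA.curl_mul_pderiv_left a b q)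
    (hA.curl_mul_pderiv_right a b p) (hA.curl_mul_pderiv_right a b q) (hA.curl_plucker a b p q)

variable {P : Ideal (MvPolynomial (Fin m) ℂ)}

theorem IsTwistedForm.exists_mul_mem_span_pair (hA : IsTwistedForm Δ D A)
    (hrad : (singularIdeal A).IsRadical) (hP : P ∈ (singularIdeal A).minimalPrimes)
    {a b : Fin m} (hab : curl A a b ∉ P) {q} (hq : q ∈ P) :
    ∃ s ∉ P, s * q ∈ Ideal.span {A a, A b} := by
  have : P.IsPrime := Ideal.IsMinimalPrime.isPrime hP
  obtain ⟨t, ht, htq⟩ := exists_notMem_mul_mem hrad hP hq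
  refine ⟨curl A a b * t, fun h => (Ideal.IsPrime.mem_or_mem ‹_› h).elim hab ht, ?_⟩
  rw [mul_assoc]
  have : ∀ x ∈ singularIdeal A, curl A a b * x ∈ Ideal.span {A a, A b} := by
    intro x hx
    induction hx using Submodule.span_induction with
    | mem x hx =>
      obtain ⟨i, rfl⟩ := hx
      rw [hA.curl_mul_mem_span_pair]
      exact Ideal.mem_span_pair.2 ⟨_, _, rfl⟩
    | zero => simp
    | add x y _ _ hx hy => rw [mul_add]; exact add_mem hx hy
    | smul c x _ hx => rw [smul_eq_mul, mul_left_comm]; exact Ideal.mul_mem_left _ _ hx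
  exact this _ htq

theorem IsTwistedForm.exists_minor_notMem (hA : IsTwistedForm Δ D A)
    (hrad : (singularIdeal A).IsRadical) (hcod : 2 ≤ (singularIdeal A).height)
    (hP : P ∈ (singularIdeal A).minimalPrimes) {a b : Fin m} (hab : curl A a b ∉ P) :
    ∃ j k, pderiv j (A a) * pderiv k (A b) - pderiv k (A a) * pderiv j (A b) ∉ P := by
  by_contra! h
  have : P.IsPrime := Ideal.IsMinimalPrime.isPrime hP
  have hJP : singularIdeal A ≤ P := Ideal.IsMinimalPrime.le hP
  have h1 := height_le_one_of_minors_mem P (hJP (mem_singularIdeal A a))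
    (hJP (mem_singularIdeal A b)) (fun q hq => hA.exists_mul_mem_span_pair hrad hP hab hq) h
  exact absurd ((hcod.trans (Ideal.height_mono hJP)).trans h1) (by decide)

end SingularLocus

end ToricPullback

namespace ToricPullback

/-! ### Behaviour of ideals under flat extension. -/

section Flat

variable {R T : Type*} [CommRing R] [CommRing T] [Algebra R T]

/-- Non-zero-divisors modulo an ideal are preserved by flat base change. -/
theorem mem_map_of_mul_mem_of_flat [Module.Flat R T] {J : Ideal R} {s : R}
    (hs : ∀ r, s * r ∈ J → r ∈ J) {t : T} (ht : algebraMap R T s * t ∈ J.map (algebraMap R T)) :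
    t ∈ J.map (algebraMap R T) := by
  have h1 : IsSMulRegular (R ⧸ J) s := by
    intro x y hxy
    obtain ⟨x, rfl⟩ := Ideal.Quotient.mk_surjective x
    obtain ⟨y, rfl⟩ := Ideal.Quotient.mk_surjective y
    have h2 : Ideal.Quotient.mk J (s * x) = Ideal.Quotient.mk J (s * y) := hxy
    rw [Ideal.Quotient.eq] at h2 ⊢
    exact hs _ (by rwa [mul_sub])
  have h2 := h1.of_flat_of_isBaseChange (TensorProduct.isBaseChange R (R ⧸ J) T)
  let e := Algebra.TensorProduct.quotIdealMapEquivTensorQuot T J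
  rw [← Ideal.Quotient.eq_zero_iff_mem] at ht ⊢
  apply e.injective
  rw [map_zero]
  apply h2
  change algebraMap R T s • e _ = algebraMap R T s • (0 : TensorProduct R T (R ⧸ J))
  rw [smul_zero, ← map_smul, ← map_zero e, ← ht, map_mul]
  rfl

theorem height_le_height_of_flat [IsNoetherianRing R] [IsNoetherianRing T] [Module.Flat R T]
    (Q : Ideal T) [Q.IsPrime] : (Q.comap (algebraMap R T)).height ≤ Q.height := by
  have : Q.LiesOver (Q.comap (algebraMap R T)) := ⟨rfl⟩
  rw [Ideal.height_eq_height_add_of_liesOver_of_hasGoingDown (Q.comap (algebraMap R T)) Q]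
  exact le_self_add

/-- An embedded or isolated prime of `J T`, where `J` is radical and `T` is flat over `R`, lies
over a minimal prime of `J`. -/
theorem comap_mem_minimalPrimes_of_flat [IsNoetherianRing R] [Module.Flat R T] {J : Ideal R}
    (hJ : J.IsRadical) {Q : Ideal T} [Q.IsPrime] {g : T}
    (hg : ∀ q, q * g ∈ J.map (algebraMap R T) ↔ q ∈ Q) :
    Q.comap (algebraMap R T) ∈ J.minimalPrimes := by
  classical
  have hIQ : J.map (algebraMap R T) ≤ Q := fun q hq => (hg q).1 (Ideal.mul_mem_right _ _ hq)
  have hJP : J ≤ Q.comap (algebraMap R T) := Ideal.map_le_iff_le_comap.1 hIQ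
  have hfin := J.finite_minimalPrimes_of_isNoetherianRing
  -- Prime avoidance yields s in the contraction of Q outside all minimal primes of J. It is regular
  -- modulo the radical ideal J, hence modulo J T, although it kills the class of g.
  by_contra hmin
  have havoid : ¬ ((Q.comap (algebraMap R T) : Ideal R) : Set R) ⊆
      ⋃ p ∈ (hfin.toFinset : Set (Ideal R)), p := by
    intro h
    obtain ⟨p, hp, hle⟩ := (Ideal.subset_union_prime (f := fun p : Ideal R => p) ⊤ ⊤
      (fun p hp _ _ => Ideal.IsMinimalPrime.isPrime (hfin.mem_toFinset.1 hp))).1 h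
    have hp' := hfin.mem_toFinset.1 hp
    have heq : p = Q.comap (algebraMap R T) :=
      le_antisymm (hp'.2 ⟨inferInstance, hJP⟩ hle) hle
    exact hmin (heq ▸ hp')
  obtain ⟨s, hsQ, hs⟩ := Set.not_subset.1 havoid
  simp only [Set.mem_iUnion, not_exists, Finset.mem_coe, Set.Finite.mem_toFinset] at hs
  have hreg : ∀ r, s * r ∈ J → r ∈ J := by
    intro r hr
    rw [← hJ.radical, ← Ideal.sInf_minimalPrimes, Ideal.mem_sInf]
    intro p hp
    have : p.IsPrime := Ideal.IsMinimalPrime.isPrime hp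
    exact ((Ideal.IsPrime.mem_or_mem this ((Ideal.IsMinimalPrime.le hp) hr)).resolve_left
      (hs p hp))
  have h1 : g ∈ J.map (algebraMap R T) := mem_map_of_mul_mem_of_flat hreg ((hg _).2 hsQ)
  exact (Ideal.IsPrime.ne_top ‹Q.IsPrime›) ((Ideal.eq_top_iff_one Q).2
    ((hg 1).1 (by rwa [one_mul])))

end Flat

/-! ### Ideals tested at their associated primes. -/

section AssociatedPrimes

variable {T : Type*} [CommRing T]

theorem exists_associatedPrime [IsNoetherianRing T] (I : Ideal T) {x : T} (hx : x ∉ I) :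
    ∃ (Q : Ideal T) (g : T), Q.IsPrime ∧ (∀ q, q * g ∈ I ↔ q ∈ Q) ∧ ∀ q, q * x ∈ I → q ∈ Q := by
  obtain ⟨Q, hQ, hle⟩ := exists_le_isAssociatedPrime_of_isNoetherianRing T
    (Ideal.Quotient.mk I x) (by rwa [Ne, Ideal.Quotient.eq_zero_iff_mem])
  obtain ⟨hprime, y, hy⟩ := isAssociatedPrime_iff.1 hQ
  obtain ⟨g, rfl⟩ := Ideal.Quotient.mk_surjective y
  have key : ∀ q z : T, q ∈ (⊥ : Submodule T (T ⧸ I)).colon {Ideal.Quotient.mk I z} ↔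
      q * z ∈ I := by
    intro q z
    rw [Submodule.mem_colon_singleton, Submodule.mem_bot, ← Ideal.Quotient.eq_zero_iff_mem]
    rfl
  exact ⟨Q, g, hprime, fun q => by rw [hy, key], fun q hq => hle ((key q x).2 hq)⟩

/-- If `I` is generated at each of its associated primes by the prime itself, it is radical. -/
theorem isRadical_of_forall_associatedPrime [IsNoetherianRing T] {I : Ideal T}
    (h : ∀ (Q : Ideal T) (g : T), Q.IsPrime → (∀ q, q * g ∈ I ↔ q ∈ Q) →
      ∀ q ∈ Q, ∃ s ∉ Q, s * q ∈ I) : I.IsRadical := by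
  intro x hx
  obtain ⟨n, hn⟩ := hx
  by_contra hxI
  obtain ⟨Q, g, hQ, hg, hle⟩ := exists_associatedPrime I hxI
  have hIQ : I ≤ Q := fun q hq => (hg q).1 (Ideal.mul_mem_right _ _ hq)
  obtain ⟨s, hs, hsx⟩ := h Q g hQ hg x (hQ.mem_of_pow_mem n (hIQ hn))
  exact hs (hle s hsx)

/-- If `C` is not contained in any associated prime of `I`, then `(I : C) = I`. -/
theorem mem_of_forall_mul_mem [IsNoetherianRing T] {I C : Ideal T}
    (h : ∀ (Q : Ideal T) (g : T), Q.IsPrime → (∀ q, q * g ∈ I ↔ q ∈ Q) → ¬ C ≤ Q) {x : T}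
    (hx : ∀ c ∈ C, c * x ∈ I) : x ∈ I := by
  by_contra hxI
  obtain ⟨Q, g, hQ, hg, hle⟩ := exists_associatedPrime I hxI
  exact h Q g hQ hg fun c hc => hle c (hx c hc)

end AssociatedPrimes

/-! ### Regular pairs from factoriality and flatness. -/

section RegularPair

open IsLocalRing

variable {R T : Type*} [CommRing R] [CommRing T] [Algebra R T]

/-- Two elements which generate a prime of height at least two locally become a regular
sequence in the local rings of a flat algebra. -/
theorem regular_pair_of_flat [IsDomain R] [IsNoetherianRing R] [UniqueFactorizationMonoid R]
    [Module.Flat R T] {a b : R} (ha : a ≠ 0) {Q : Ideal T} [Q.IsPrime]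
    (haP : algebraMap R T a ∈ Q) (hbP : algebraMap R T b ∈ Q)
    (hgen : ∀ q ∈ Q.comap (algebraMap R T), ∃ s ∉ Q.comap (algebraMap R T),
      s * q ∈ Ideal.span {a, b})
    (hht : ¬ (Q.comap (algebraMap R T)).height ≤ 1) :
    (∀ r : Localization.AtPrime Q, algebraMap T _ (algebraMap R T a) * r = 0 → r = 0) ∧
    (∀ r : Localization.AtPrime Q, algebraMap T _ (algebraMap R T b) * r ∈
        Ideal.span {algebraMap T (Localization.AtPrime Q) (algebraMap R T a)} →
      r ∈ Ideal.span {algebraMap T (Localization.AtPrime Q) (algebraMap R T a)}) := by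
  set P := Q.comap (algebraMap R T) with hP
  obtain ⟨u, v, c, huv, hcu, hcv⟩ := UniqueFactorizationMonoid.exists_reduced_factors a ha b
  have hu : u ≠ 0 := by rintro rfl; exact ha (by rw [← hcu, mul_zero])
  -- If the common factor c were in P, then P would be minimal over (c), of height at most 1 by
  -- Krull.
  have hc : c ∉ P := by
    intro hc
    apply hht
    have hcP : Ideal.span {c} ≤ P := (Ideal.span_singleton_le_iff_mem _).2 hc
    obtain ⟨P0, hP0, hle⟩ := Ideal.exists_minimalPrimes_le hcP
    have hprime : P0.IsPrime := Ideal.IsMinimalPrime.isPrime hP0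
    have hc0 : c ∈ P0 := (Ideal.IsMinimalPrime.le hP0) (Ideal.mem_span_singleton_self c)
    have heq : P0 = P := by
      refine le_antisymm hle fun q hq => ?_
      obtain ⟨s, hs, hsq⟩ := hgen q hq
      have h1 : s * q ∈ P0 := by
        refine (Ideal.span_le.2 ?_ : Ideal.span {a, b} ≤ P0) hsq
        rintro x (rfl | rfl)
        · rw [← hcu]; exact Ideal.mul_mem_right _ _ hc0
        · rw [← hcv]; exact Ideal.mul_mem_right _ _ hc0
      exact (hprime.mem_or_mem h1).resolve_left fun h => hs (hle h)
    rw [← heq]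
    exact Ideal.height_le_one_of_isPrincipal_of_mem_minimalPrimes (Ideal.span {c}) P0 hP0
  let L := Localization.AtPrime Q
  let ψ : R →+* L := (algebraMap T L).comp (algebraMap R T)
  have : Module.Flat R L := Module.Flat.trans R T L
  have hψ : algebraMap R L = ψ := IsScalarTower.algebraMap_eq R T L
  have huc : IsUnit (ψ c) := IsLocalization.map_units L (⟨algebraMap R T c, hc⟩ : Q.primeCompl)
  have e1 : algebraMap T L (algebraMap R T a) = ψ c * ψ u := by rw [← map_mul, hcu]; rfl
  have e2 : algebraMap T L (algebraMap R T b) = ψ c * ψ v := by rw [← map_mul, hcv]; rfl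
  -- The coprime cofactors u, v form a regular sequence in R, preserved by flatness; c is a unit at
  -- Q.
  have r1 : ∀ r : L, ψ u * r = 0 → r = 0 := by
    intro r hr
    have h := mem_map_of_mul_mem_of_flat (T := L) (J := (⊥ : Ideal R)) (s := u) (t := r)
      (fun r hr => by
        rw [Ideal.mem_bot] at hr ⊢
        exact (mul_eq_zero.1 hr).resolve_left hu)
      (by rw [hψ, hr]; exact zero_mem _)
    simpa [Ideal.map_bot] using h
  have r2 : ∀ r : L, ψ v * r ∈ Ideal.span {ψ u} → r ∈ Ideal.span {ψ u} := by
    intro r hr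
    have h := mem_map_of_mul_mem_of_flat (T := L) (J := Ideal.span {u}) (s := v) (t := r)
      (fun r hr => by
        rw [Ideal.mem_span_singleton] at hr ⊢
        exact huv.dvd_of_dvd_mul_left hr)
      (by rw [Ideal.map_span, Set.image_singleton, hψ]; exact hr)
    rwa [Ideal.map_span, Set.image_singleton, hψ] at h
  have hspan : Ideal.span {algebraMap T L (algebraMap R T a)} = Ideal.span {ψ u} := by
    rw [e1, Ideal.span_singleton_mul_left_unit huc]
  refine ⟨fun r hr => ?_, fun r hr => ?_⟩
  · rw [e1, mul_assoc] at hr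
    exact r1 r (huc.mul_right_eq_zero.1 hr)
  · rw [hspan] at hr ⊢
    rw [e2, mul_assoc, Ideal.unit_mul_mem_iff_mem _ huc] at hr
    exact r2 r hr

end RegularPair

end ToricPullback

namespace ToricPullback

open MvPolynomial

variable {m n : ℕ}

/-! ### Pulling back α, dα and the minors along F. -/

section ChainRule

variable (F : Fin m → MvPolynomial (Fin (n + 1)) ℂ) (A : Fin m → MvPolynomial (Fin m) ℂ)

theorem pderiv_aeval (p : MvPolynomial (Fin m) ℂ) (j : Fin (n + 1)) :
    pderiv j (aeval F p) = ∑ i, aeval F (pderiv i p) * pderiv j (F i) := by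
  classical
  induction p using MvPolynomial.induction_on with
  | C a => simp [algebraMap_eq]
  | add p q hp hq => simp only [map_add, hp, hq, add_mul, Finset.sum_add_distrib]
  | mul_X p i hp =>
    simp only [map_mul, aeval_X, Derivation.leibniz, smul_eq_mul, hp, pderiv_X, map_add,
      add_mul, Finset.sum_add_distrib, Finset.mul_sum]
    refine congrArg₂ (· + ·) ?_ ?_
    · rw [Finset.sum_eq_single i]
      · simp
      · intro k _ hk
        simp [hk.symm]
      · simp
    · exact Finset.sum_congr rfl fun k _ => by ring

/-- The contraction `∑ A(F) dF` paired with the curl: `dω = ∑ (dα)(F) dF ∧ dF`. -/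
theorem curl_pullback (j k : Fin (n + 1)) : curl (pullback F A) j k =
    ∑ p, ∑ q, aeval F (curl A p q) * (pderiv j (F p) * pderiv k (F q)) := by
  have h : ∀ j k, pderiv j (pullback F A k) =
      ∑ q, ∑ p, aeval F (pderiv p (A q)) * (pderiv j (F p) * pderiv k (F q)) +
        ∑ q, aeval F (A q) * pderiv j (pderiv k (F q)) := by
    intro j k
    simp only [pullback, map_sum, Derivation.leibniz, smul_eq_mul, pderiv_aeval, Finset.mul_sum,
      Finset.sum_add_distrib]
    refine (add_comm _ _).trans (congrArg₂ (· + ·) ?_ rfl)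
    exact Finset.sum_congr rfl fun q _ => Finset.sum_congr rfl fun p _ => by ring
  rw [curl, h, h]
  simp only [pderiv_comm j k, add_sub_add_right_eq_sub, curl, map_sub, sub_mul,
    Finset.sum_sub_distrib]
  refine congrArg₂ (· - ·) ?_ ?_
  · exact Finset.sum_comm
  · exact Finset.sum_congr rfl fun q _ => Finset.sum_congr rfl fun p _ => by ring

theorem minor_aeval (f g : MvPolynomial (Fin m) ℂ) (j k : Fin (n + 1)) :
    pderiv j (aeval F f) * pderiv k (aeval F g) - pderiv k (aeval F f) * pderiv j (aeval F g) =
      ∑ p, ∑ q, aeval F (pderiv p f * pderiv q g - pderiv q f * pderiv p g) *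
        (pderiv j (F p) * pderiv k (F q)) := by
  simp only [pderiv_aeval, Finset.sum_mul_sum, map_sub, map_mul, sub_mul, Finset.sum_sub_distrib]
  refine congrArg₂ (· - ·) ?_ ?_
  · exact Finset.sum_congr rfl fun q _ => Finset.sum_congr rfl fun p _ => by ring
  · rw [Finset.sum_comm]
    exact Finset.sum_congr rfl fun q _ => Finset.sum_congr rfl fun p _ => by ring

/-- The extension of `J(α)` along `F^*`. -/
noncomputable def pulledIdeal : Ideal (MvPolynomial (Fin (n + 1)) ℂ) :=
  Ideal.span (Set.range fun i => aeval F (A i))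

variable {F A}

theorem aeval_mem_pulledIdeal {x : MvPolynomial (Fin m) ℂ} (hx : x ∈ singularIdeal A) :
    aeval F x ∈ pulledIdeal F A := by
  induction hx using Submodule.span_induction with
  | mem x hx =>
    obtain ⟨i, rfl⟩ := hx
    exact Ideal.subset_span ⟨i, rfl⟩
  | zero => simp
  | add x y _ _ hx hy => rw [map_add]; exact add_mem hx hy
  | smul c x _ hx => rw [smul_eq_mul, map_mul]; exact Ideal.mul_mem_left _ _ hx

theorem pulledIdeal_eq_map : pulledIdeal F A =
    (singularIdeal A).map (aeval F : MvPolynomial (Fin m) ℂ →ₐ[ℂ] _).toRingHom := by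
  rw [singularIdeal, Ideal.map_span, ← Set.range_comp]
  rfl

theorem singularIdeal_pullback_le : singularIdeal (pullback F A) ≤ pulledIdeal F A := by
  refine Ideal.span_le.2 ?_
  rintro _ ⟨j, rfl⟩
  exact sum_mem fun i _ => Ideal.mul_mem_right _ _
    (aeval_mem_pulledIdeal (mem_singularIdeal A i))

variable {Δ : CompleteFan m} {D : Fin m → ℤ}

/-- Contracting α ∧ dα = 0 with ∂_i gives A_i dα = α ∧ i_{∂_i} dα; the pullback exhibits A_i(F) dω
as a multiple of ω. -/
theorem IsTwistedForm.pulledIdeal_le_kupkaIdeal (hA : IsTwistedForm Δ D A) :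
    pulledIdeal F A ≤ kupkaIdeal (pullback F A) := by
  refine Ideal.span_le.2 ?_
  rintro _ ⟨i, rfl⟩
  refine Submodule.mem_colon.2 fun c hc => ?_
  rw [smul_eq_mul]
  have hc' : c ∈ dIdeal (pullback F A) := hc
  clear hc
  induction hc' using Submodule.span_induction with
  | mem x hx =>
    obtain ⟨⟨j, k⟩, rfl⟩ := hx
    change _ * curl (pullback F A) j k ∈ _
    let u : MvPolynomial (Fin (n + 1)) ℂ := ∑ q, aeval F (curl A i q) * pderiv k (F q)
    let v : MvPolynomial (Fin (n + 1)) ℂ := ∑ p, aeval F (curl A p i) * pderiv j (F p)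
    have key : aeval F (A i) * curl (pullback F A) j k =
        v * pullback F A k + u * pullback F A j := by
      rw [curl_pullback]
      simp only [u, v, pullback]
      rw [Finset.sum_mul_sum, Finset.sum_mul_sum, Finset.mul_sum]
      rw [Finset.sum_comm (f := fun q p => aeval F (curl A i q) * pderiv k (F q) *
        (aeval F (A p) * pderiv j (F p)))]
      rw [← Finset.sum_add_distrib]
      refine Finset.sum_congr rfl fun p _ => ?_
      rw [← Finset.sum_add_distrib, Finset.mul_sum]
      refine Finset.sum_congr rfl fun q _ => ?_
      have h := congrArg (aeval F) (hA.integrable i p q)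
      rw [curl_swap A q i] at h
      simp only [map_add, map_mul, map_neg, map_zero] at h
      have h2 : aeval F (curl A p i) = -aeval F (curl A i p) := by
        rw [curl_swap, map_neg]
      linear_combination (pderiv j (F p) * pderiv k (F q)) * h -
        (aeval F (A q) * pderiv j (F p) * pderiv k (F q)) * h2
    rw [key]
    exact add_mem (Ideal.mul_mem_left _ _ (mem_singularIdeal _ k))
      (Ideal.mul_mem_left _ _ (mem_singularIdeal _ j))
  | zero => simp
  | add x y _ _ hx hy => rw [mul_add]; exact add_mem hx hy
  | smul c x _ hx => rw [smul_eq_mul, mul_left_comm]; exact Ideal.mul_mem_left _ _ hx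

theorem IsTwistedForm.minor_sub_curl_pullback_mem (hA : IsTwistedForm Δ D A) (a b : Fin m)
    (j k : Fin (n + 1)) :
    aeval F (curl A a b) ^ 2 * (pderiv j (aeval F (A a)) * pderiv k (aeval F (A b)) -
        pderiv k (aeval F (A a)) * pderiv j (aeval F (A b))) -
      aeval F ((pderiv a (A a) * pderiv b (A b) - pderiv b (A a) * pderiv a (A b)) *
        curl A a b) * curl (pullback F A) j k ∈ pulledIdeal F A := by
  rw [minor_aeval, curl_pullback, Finset.mul_sum, Finset.mul_sum, ← Finset.sum_sub_distrib]
  refine sum_mem fun p _ => ?_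
  rw [Finset.mul_sum, Finset.mul_sum, ← Finset.sum_sub_distrib]
  refine sum_mem fun q _ => ?_
  have h := Ideal.mul_mem_right (pderiv j (F p) * pderiv k (F q)) _
    (aeval_mem_pulledIdeal (F := F) (hA.minor_sub_curl_mem a b p q))
  convert h using 1
  simp only [map_sub, map_mul, map_pow]
  ring

end ChainRule

/-! ### Homogeneity of the pulled-back coefficients. -/

section Homogeneity

variable {F : Fin m → MvPolynomial (Fin (n + 1)) ℂ} {A : Fin m → MvPolynomial (Fin m) ℂ}
  {Δ : CompleteFan m} {D : Fin m → ℤ} {e : Fin m → ℕ}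

/-- Since e is a relation among the rays, pairing with it factors through Cl(X) and turns the
class-group grading into an ordinary degree. -/
theorem IsTwistedForm.degree_support (hA : IsTwistedForm Δ D A)
    (he : Δ.IsRelation fun i => (e i : ℤ)) {i : Fin m} {u : Fin m →₀ ℕ}
    (hu : u ∈ (A i).support) : (∑ k, e k * u k : ℕ) + (e i : ℤ) = ∑ k, e k * D k := by
  obtain ⟨w, hw⟩ := hA.homogeneous i u hu
  have h1 : ∑ k, (e k : ℤ) * ((u k : ℤ) + (if k = i then 1 else 0) - D k) = 0 := by
    simp only [hw, Finset.mul_sum]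
    rw [Finset.sum_comm]
    refine Finset.sum_eq_zero fun l _ => ?_
    have := he l
    calc ∑ k, (e k : ℤ) * (w l * Δ.ray k l) = w l * ∑ k, (e k : ℤ) * Δ.ray k l := by
          rw [Finset.mul_sum]; exact Finset.sum_congr rfl fun k _ => by ring
      _ = 0 := by rw [this, mul_zero]
  simp only [mul_sub, mul_add, Finset.sum_sub_distrib, Finset.sum_add_distrib, mul_ite, mul_one,
    mul_zero, Finset.sum_ite_eq', Finset.mem_univ, if_true] at h1
  push_cast
  linarith

theorem IsTwistedForm.isHomogeneous_aeval (hA : IsTwistedForm Δ D A)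
    (he : Δ.IsRelation fun i => (e i : ℤ)) (hF : ∀ i, (F i).IsHomogeneous (e i)) (i : Fin m) :
    (aeval F (A i)).IsHomogeneous (∑ k, e k * D k - e i : ℤ).toNat := by
  rw [aeval_def, eval₂_eq']
  refine IsHomogeneous.sum _ _ _ fun u hu => ?_
  have h1 := (isHomogeneous_C (Fin (n + 1)) (coeff u (A i))).mul
    (IsHomogeneous.prod Finset.univ (fun k => F k ^ u k) (fun k => e k * u k)
      fun k _ => (hF k).pow (u k))
  have h2 := hA.degree_support he hu
  rw [algebraMap_eq]
  convert h1 using 1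
  omega

theorem IsTwistedForm.isHomogeneous_pullback (hA : IsTwistedForm Δ D A)
    (he : Δ.IsRelation fun i => (e i : ℤ)) (hF : ∀ i, (F i).IsHomogeneous (e i))
    (j : Fin (n + 1)) :
    (pullback F A j).IsHomogeneous (∑ k, e k * D k - 1 : ℤ).toNat := by
  refine IsHomogeneous.sum _ _ _ fun i _ => ?_
  by_cases hi : A i = 0
  · rw [hi, map_zero, zero_mul]; exact isHomogeneous_zero _ _ _
  obtain ⟨u, hu⟩ := Finset.nonempty_iff_ne_empty.2 (support_eq_empty.not.2 hi)
  have h2 := hA.degree_support he hu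
  -- When e_i = 0 the truncated degree e_i - 1 is wrong, but F_i is then constant and the term
  -- vanishes.
  by_cases h0 : e i = 0
  · have h3 := hF i
    rw [h0, ← totalDegree_zero_iff_isHomogeneous, totalDegree_eq_zero_iff_eq_C] at h3
    rw [h3, pderiv_C, mul_zero]; exact isHomogeneous_zero _ _ _
  · have h1 := (hA.isHomogeneous_aeval he hF i).mul ((hF i).pderiv (i := j))
    convert h1 using 1
    omega

theorem eval_smul_of_isHomogeneous {f : MvPolynomial (Fin (n + 1)) ℂ} {d : ℕ}
    (hf : f.IsHomogeneous d) (c : ℂ) (x : Fin (n + 1) → ℂ) :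
    eval (c • x) f = c ^ d * eval x f := by
  rw [eval_eq', eval_eq', Finset.mul_sum]
  refine Finset.sum_congr rfl fun u hu => ?_
  have h := hf (mem_support_iff.1 hu)
  rw [Finsupp.weight_apply, Finsupp.sum_fintype _ _ (by simp)] at h
  simp only [Pi.one_apply, smul_eq_mul, mul_one, Pi.smul_apply, mul_pow,
    Finset.prod_mul_distrib, Finset.prod_pow_eq_pow_sum] at h ⊢
  rw [h]
  ring

end Homogeneity

end ToricPullback

namespace ToricPullback

open MvPolynomial

variable {m n : ℕ}

/-! ### Associated primes of I. -/

section AssociatedPrimeOfPullback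

open IsLocalRing

variable {F : Fin m → MvPolynomial (Fin (n + 1)) ℂ} {A : Fin m → MvPolynomial (Fin m) ℂ}
  {Δ : CompleteFan m} {D : Fin m → ℤ}

theorem IsTwistedForm.curl_mul_mem_span_pair_aeval (hA : IsTwistedForm Δ D A) (a b : Fin m)
    {x : MvPolynomial (Fin (n + 1)) ℂ} (hx : x ∈ pulledIdeal F A) :
    aeval F (curl A a b) * x ∈ Ideal.span {aeval F (A a), aeval F (A b)} := by
  induction hx using Submodule.span_induction with
  | mem x hx =>
    obtain ⟨i, rfl⟩ := hx
    rw [← map_mul, hA.curl_mul_mem_span_pair]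
    refine Ideal.mem_span_pair.2 ⟨aeval F (-curl A b i), aeval F (curl A a i), ?_⟩
    simp
  | zero => simp
  | add x y _ _ hx hy => rw [mul_add]; exact add_mem hx hy
  | smul c x _ hx => rw [smul_eq_mul, mul_left_comm]; exact Ideal.mul_mem_left _ _ hx

variable {Q : Ideal (MvPolynomial (Fin (n + 1)) ℂ)} [Q.IsPrime]

/-- The local structure of `⟨A₁(F), …, Aₘ(F)⟩` at a codimension two component `Q`: two of the
coefficients form a regular sequence which generates it at `Q`. -/
structure IsLocalPair (F : Fin m → MvPolynomial (Fin (n + 1)) ℂ)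
    (A : Fin m → MvPolynomial (Fin m) ℂ) (Q : Ideal (MvPolynomial (Fin (n + 1)) ℂ)) [Q.IsPrime]
    (a b : Fin m) : Prop where
  le : pulledIdeal F A ≤ Q
  curl_notMem : aeval F (curl A a b) ∉ Q
  minor_notMem : ∃ j k, aeval F (pderiv j (A a) * pderiv k (A b) -
    pderiv k (A a) * pderiv j (A b)) ∉ Q
  regular_left : ∀ r : Localization.AtPrime Q, algebraMap _ _ (aeval F (A a)) * r = 0 → r = 0
  regular_right : ∀ r : Localization.AtPrime Q, algebraMap _ _ (aeval F (A b)) * r ∈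
      Ideal.span {algebraMap _ (Localization.AtPrime Q) (aeval F (A a))} →
    r ∈ Ideal.span {algebraMap _ (Localization.AtPrime Q) (aeval F (A a))}
  height : Q.height = 2
  minimal : Q ∈ (pulledIdeal F A).minimalPrimes

theorem IsTwistedForm.exists_isLocalPair (hA : IsTwistedForm Δ D A)
    (hflat : (aeval F : MvPolynomial (Fin m) ℂ →ₐ[ℂ] MvPolynomial (Fin (n + 1)) ℂ).toRingHom.Flat)
    (hrad : (singularIdeal A).IsRadical) (hcod : 2 ≤ (singularIdeal A).height)
    (hd : 3 ≤ (dIdeal A).height) {g : MvPolynomial (Fin (n + 1)) ℂ}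
    (hg : ∀ q, q * g ∈ pulledIdeal F A ↔ q ∈ Q) : ∃ a b, IsLocalPair F A Q a b := by
  let _ : Algebra (MvPolynomial (Fin m) ℂ) (MvPolynomial (Fin (n + 1)) ℂ) :=
    (aeval F : MvPolynomial (Fin m) ℂ →ₐ[ℂ] MvPolynomial (Fin (n + 1)) ℂ).toRingHom.toAlgebra
  have : Module.Flat (MvPolynomial (Fin m) ℂ) (MvPolynomial (Fin (n + 1)) ℂ) := hflat
  have hmap : pulledIdeal F A = (singularIdeal A).map (algebraMap _ _) := pulledIdeal_eq_map
  have hIQ : pulledIdeal F A ≤ Q := fun q hq => (hg q).1 (Ideal.mul_mem_right _ _ hq)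
  set P := Q.comap (algebraMap (MvPolynomial (Fin m) ℂ) _) with hPdef
  have hP : P ∈ (singularIdeal A).minimalPrimes :=
    comap_mem_minimalPrimes_of_flat hrad (by rw [← hmap]; exact hg)
  have hJP : singularIdeal A ≤ P := Ideal.IsMinimalPrime.le hP
  have hPprime : P.IsPrime := Ideal.IsMinimalPrime.isPrime hP
  have hP2 : 2 ≤ P.height := hcod.trans (Ideal.height_mono hJP)
  obtain ⟨a, b, hab⟩ := hA.exists_curl_notMem hrad hd hP
  have hgen := fun q hq => hA.exists_mul_mem_span_pair hrad hP hab (q := q) hq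
  have hP1 : ¬ P.height ≤ 1 := fun h => absurd (hP2.trans h) (by decide)
  obtain ⟨j, k, hjk⟩ := hA.exists_minor_notMem hrad hcod hP hab
  have ha0 : A a ≠ 0 := by
    intro h
    apply hjk
    simp [h]
  have hmem : ∀ i, algebraMap _ _ (A i) ∈ Q := fun i => hJP (mem_singularIdeal A i)
  obtain ⟨h1, h2⟩ := regular_pair_of_flat ha0 (hmem a) (hmem b) hgen hP1
  let L := Localization.AtPrime Q
  let ι := algebraMap (MvPolynomial (Fin (n + 1)) ℂ) L
  have hs : IsUnit (ι (aeval F (curl A a b))) :=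
    IsLocalization.map_units L (⟨_, hab⟩ : Q.primeCompl)
  have hspan : ∀ x ∈ pulledIdeal F A,
      ι x ∈ Ideal.span {ι (aeval F (A a)), ι (aeval F (A b))} := by
    intro x hx
    have h := Ideal.mem_map_of_mem ι (hA.curl_mul_mem_span_pair_aeval a b hx)
    rwa [map_mul, Ideal.unit_mul_mem_iff_mem _ hs, Ideal.map_span, Set.image_pair] at h
  -- As Q = (I : g), the class of g is a socle element of the local ring modulo the regular pair.
  have hdim : ringKrullDim L ≤ 2 := by
    refine ringKrullDim_le_two_of_socle (g := ι g) h1 h2 ?_ ?_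
    · intro hmem'
      change ι g ∈ Ideal.span {ι (aeval F (A a)), ι (aeval F (A b))} at hmem'
      rw [← Set.image_pair, ← Ideal.map_span, algebraMap_mem_map_iff] at hmem'
      obtain ⟨s, hs, hsg⟩ := hmem'
      refine hs ((hg s).1 (Ideal.span_le.2 ?_ hsg))
      rintro x (rfl | rfl) <;> exact aeval_mem_pulledIdeal (mem_singularIdeal A _)
    · intro z hz
      rw [← Localization.AtPrime.map_eq_maximalIdeal] at hz
      induction hz using Submodule.span_induction with
      | mem x hx =>
        obtain ⟨q, hq, rfl⟩ := hx
        rw [← map_mul]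
        exact hspan _ ((hg q).2 hq)
      | zero => simp
      | add x y _ _ hx hy => rw [add_mul]; exact add_mem hx hy
      | smul c x _ hx => rw [smul_eq_mul, mul_assoc]; exact Ideal.mul_mem_left _ _ hx
  rw [IsLocalization.AtPrime.ringKrullDim_eq_height Q L] at hdim
  have hQ2 : Q.height ≤ 2 := WithBot.coe_le_coe.1 hdim
  -- Going down for flat extensions transfers codimension at least 2 from J(α); this also makes Q
  -- minimal over I.
  have hflatht : ∀ (Q' : Ideal (MvPolynomial (Fin (n + 1)) ℂ)) [Q'.IsPrime],
      pulledIdeal F A ≤ Q' → 2 ≤ Q'.height := by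
    intro Q' _ hle
    refine le_trans ?_ (height_le_height_of_flat (R := MvPolynomial (Fin m) ℂ) Q')
    refine hcod.trans (Ideal.height_mono ?_)
    rw [hmap] at hle
    exact Ideal.map_le_iff_le_comap.1 hle
  refine ⟨a, b, hIQ, hab, ⟨j, k, hjk⟩, h1, h2, le_antisymm hQ2 (hflatht Q hIQ), ?_⟩
  obtain ⟨Q', hQ', hle⟩ := Ideal.exists_minimalPrimes_le hIQ
  have hprime : Q'.IsPrime := Ideal.IsMinimalPrime.isPrime hQ'
  rcases hle.lt_or_eq with hlt | rfl
  · have h3 := hflatht Q' (Ideal.IsMinimalPrime.le hQ')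
    have h4 := Ideal.height_add_one_le_of_lt_of_isPrime hlt
    have h5 : (2 : ℕ∞) + 1 ≤ 2 := (add_le_add_left h3 1).trans (h4.trans hQ2)
    exact absurd h5 (by decide)
  · exact hQ'

variable {a b : Fin m}

theorem IsLocalPair.exists_mul_mem_span_pair (h : IsLocalPair F A Q a b)
    (hA : IsTwistedForm Δ D A) {x : MvPolynomial (Fin (n + 1)) ℂ} (hx : x ∈ pulledIdeal F A) :
    ∃ s ∉ Q, s * x ∈ Ideal.span {aeval F (A a), aeval F (A b)} :=
  ⟨_, h.curl_notMem, hA.curl_mul_mem_span_pair_aeval a b hx⟩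

/-- If the ideal is generically reduced along `Q`, then `dω` does not vanish there. -/
theorem IsLocalPair.not_dIdeal_le (h : IsLocalPair F A Q a b) (hA : IsTwistedForm Δ D A)
    (hgen : ∀ q ∈ Q, ∃ s ∉ Q, s * q ∈ pulledIdeal F A) : ¬ dIdeal (pullback F A) ≤ Q := by
  intro hle
  have hmem : ∀ i, aeval F (A i) ∈ Q := fun i =>
    h.le (aeval_mem_pulledIdeal (mem_singularIdeal A i))
  have hprime : Q.IsPrime := inferInstance
  -- If dω vanishes along Q, so do the minors of the gradients of A_a(F), A_b(F), which generate Q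
  -- locally.
  have h1 : Q.height ≤ 1 := by
    refine height_le_one_of_minors_mem Q (hmem a) (hmem b) ?_ ?_
    · intro q hq
      obtain ⟨s, hs, hsq⟩ := hgen q hq
      obtain ⟨t, ht, htq⟩ := h.exists_mul_mem_span_pair hA hsq
      refine ⟨t * s, fun h => (hprime.mem_or_mem h).elim ht hs, by rwa [mul_assoc]⟩
    · intro j k
      have h1 := h.le (hA.minor_sub_curl_pullback_mem (F := F) a b j k)
      have h2 : curl (pullback F A) j k ∈ Q := hle (Ideal.subset_span ⟨(j, k), rfl⟩)
      have h3 := add_mem h1 (Ideal.mul_mem_left _ (aeval F ((pderiv a (A a) * pderiv b (A b) -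
        pderiv b (A a) * pderiv a (A b)) * curl A a b)) h2)
      rw [sub_add_cancel] at h3
      exact (hprime.mem_or_mem h3).resolve_left fun h4 =>
        h.curl_notMem (hprime.mem_of_pow_mem 2 h4)
  rw [h.height] at h1
  exact absurd h1 (by decide)

end AssociatedPrimeOfPullback

end ToricPullback

namespace ToricPullback

open MvPolynomial IsLocalRing

/-! ### Independent gradients and heights of primes. -/

section CotangentIndependence

theorem pderiv_mem_of_mem_sq {σ : Type*} {P : Ideal (MvPolynomial σ ℂ)} {x : MvPolynomial σ ℂ}
    (hx : x ∈ P ^ 2) (j : σ) : pderiv j x ∈ P := by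
  rw [sq] at hx
  induction hx using Submodule.mul_induction_on' with
  | mem_mul_mem x hx y hy =>
    rw [Derivation.leibniz]
    exact add_mem (Ideal.mul_mem_right _ _ hx) (Ideal.mul_mem_right _ _ hy)
  | add x _ y _ hx hy => rw [map_add]; exact add_mem hx hy

variable {σ ι : Type*} [Fintype ι]

variable (P : Ideal (MvPolynomial σ ℂ)) [P.IsPrime] (f : ι → MvPolynomial σ ℂ)

/-- Polynomials whose gradients are independent along `P` are independent modulo `P²`. -/
theorem linearIndependent_toCotangent (hf : ∀ i, f i ∈ P)
    (hlin : ∀ t : ι → MvPolynomial σ ℂ, (∀ j, ∑ i, t i * pderiv j (f i) ∈ P) → ∀ i, t i ∈ P) :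
    LinearIndependent (ResidueField (Localization.AtPrime P)) fun i =>
      (maximalIdeal (Localization.AtPrime P)).toCotangent
        ⟨algebraMap _ (Localization.AtPrime P) (f i),
          (IsLocalization.AtPrime.to_map_mem_maximal_iff _ P _).2 (hf i)⟩ := by
  let L := Localization.AtPrime P
  have hfL : ∀ i, algebraMap _ L (f i) ∈ maximalIdeal L := fun i =>
    (IsLocalization.AtPrime.to_map_mem_maximal_iff L P _).2 (hf i)
  rw [Fintype.linearIndependent_iff]
  intro c hc i
  have hl : ∀ i, ∃ l : L, residue L l = c i := fun i => residue_surjective (c i)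
  choose l hl using hl
  have h1 : ∀ i, c i • (maximalIdeal L).toCotangent ⟨_, hfL i⟩ =
      (maximalIdeal L).toCotangent (l i • ⟨_, hfL i⟩) := by
    intro i
    rw [map_smul, ← hl i]
    rfl
  rw [Finset.sum_congr rfl fun i _ => h1 i, ← map_sum, Ideal.toCotangent_eq_zero] at hc
  obtain ⟨⟨b, hb⟩, hint⟩ := IsLocalization.exist_integer_multiples_of_finite P.primeCompl l
  choose t ht using hint
  have ht' : ∀ i, algebraMap _ L (t i) = algebraMap _ L b * l i := fun i => by
    rw [ht i, Algebra.smul_def]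
  have h2 : algebraMap _ L (∑ i, t i * f i) ∈ (P ^ 2).map (algebraMap _ L) := by
    rw [Ideal.map_pow, Localization.AtPrime.map_eq_maximalIdeal]
    have := Ideal.mul_mem_left _ (algebraMap _ L b) hc
    convert this using 1
    simp only [map_sum, map_mul, ht', AddSubmonoidClass.coe_finsetSum, Submodule.coe_smul,
      smul_eq_mul, Finset.mul_sum, mul_assoc]
  rw [algebraMap_mem_map_iff] at h2
  obtain ⟨s, hs, hsm⟩ := h2
  -- After clearing denominators, s ∑ t_i f_i lies in P², whose elements have all their derivatives
  -- in P.
  have h3 : ∀ j, ∑ i, t i * pderiv j (f i) ∈ P := by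
    intro j
    have h4 := pderiv_mem_of_mem_sq hsm j
    have hsum : ∑ i, t i * f i ∈ P := sum_mem fun i _ => Ideal.mul_mem_left _ _ (hf i)
    rw [Derivation.leibniz, smul_eq_mul, smul_eq_mul] at h4
    replace h4 := sub_mem h4 (Ideal.mul_mem_right (pderiv j s) _ hsum)
    rw [add_sub_cancel_right] at h4
    replace h4 := (Ideal.IsPrime.mem_or_mem ‹_› h4).resolve_left hs
    rw [map_sum] at h4
    simp only [Derivation.leibniz, smul_eq_mul, Finset.sum_add_distrib] at h4
    have h5 : ∑ i, f i * pderiv j (t i) ∈ P :=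
      sum_mem fun i _ => Ideal.mul_mem_right _ _ (hf i)
    replace h4 := sub_mem h4 h5
    rwa [add_sub_cancel_right] at h4
  have h6 : algebraMap _ L (t i) ∈ maximalIdeal L :=
    (IsLocalization.AtPrime.to_map_mem_maximal_iff L P _).2 (hlin t h3 i)
  have hu : IsUnit (algebraMap _ L b) := IsLocalization.map_units L (⟨b, hb⟩ : P.primeCompl)
  rw [ht', Ideal.unit_mul_mem_iff_mem _ hu] at h6
  rw [← hl i]
  exact (residue_eq_zero_iff _).2 h6

theorem card_le_height_of_gradients [Fintype σ] (hf : ∀ i, f i ∈ P)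
    (hlin : ∀ t : ι → MvPolynomial σ ℂ, (∀ j, ∑ i, t i * pderiv j (f i) ∈ P) → ∀ i, t i ∈ P) :
    (Fintype.card ι : ℕ∞) ≤ P.height := by
  rw [height_eq_finrank_cotangentSpace]
  exact_mod_cast (linearIndependent_toCotangent P f hf hlin).fintype_card_le_finrank

/-- A prime of height `d` is generated locally by `d` elements with independent gradients. -/
theorem exists_mul_mem_span_of_gradients [Fintype σ] (hf : ∀ i, f i ∈ P)
    (hlin : ∀ t : ι → MvPolynomial σ ℂ, (∀ j, ∑ i, t i * pderiv j (f i) ∈ P) → ∀ i, t i ∈ P)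
    (hle : P.height ≤ Fintype.card ι) :
    ∀ q ∈ P, ∃ s ∉ P, s * q ∈ Ideal.span (Set.range f) := by
  classical
  let L := Localization.AtPrime P
  have hfL : ∀ i, algebraMap _ L (f i) ∈ maximalIdeal L := fun i =>
    (IsLocalization.AtPrime.to_map_mem_maximal_iff L P _).2 (hf i)
  have hli := linearIndependent_toCotangent P f hf hlin
  have hle' : Module.finrank (ResidueField L) (CotangentSpace L) ≤ Fintype.card ι := by
    rw [height_eq_finrank_cotangentSpace] at hle
    exact_mod_cast hle
  have htop := hli.span_eq_top_of_card_eq_finrank' (le_antisymm hli.fintype_card_le_finrank hle')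
  have hspan : Submodule.span L (Set.range fun i => (⟨_, hfL i⟩ : maximalIdeal L)) = ⊤ := by
    rw [← CotangentSpace.span_image_eq_top_iff, ← Set.range_comp]
    exact htop
  have hmap : Ideal.span (Set.range fun i => algebraMap _ L (f i)) = maximalIdeal L := by
    have := congrArg (Submodule.map (maximalIdeal L).subtype) hspan
    rwa [Submodule.map_span, ← Set.range_comp, Submodule.map_top, Submodule.range_subtype] at this
  intro q hq
  rw [← algebraMap_mem_map_iff, Ideal.map_span, ← Set.range_comp]
  have := (IsLocalization.AtPrime.to_map_mem_maximal_iff L P _).2 hq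
  rwa [← hmap] at this

end CotangentIndependence

/-! ### Components of I meet ℙⁿ. -/

section ProjectivePoint

attribute [local instance] MvPolynomial.gradedAlgebra

variable {n : ℕ}

/-- The homogeneous core of Q is a prime containing I, so minimality makes it Q. -/
theorem isHomogeneous_of_mem_minimalPrimes {σ : Type*} {I Q : Ideal (MvPolynomial σ ℂ)}
    (hI : I.IsHomogeneous (homogeneousSubmodule σ ℂ)) (hQ : Q ∈ I.minimalPrimes) :
    Q.IsHomogeneous (homogeneousSubmodule σ ℂ) := by
  have hprime : Q.IsPrime := Ideal.IsMinimalPrime.isPrime hQ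
  rw [Ideal.IsHomogeneous.iff_eq]
  refine le_antisymm (Ideal.toIdeal_homogeneousCore_le _ Q) (hQ.2 ⟨hprime.homogeneousCore, ?_⟩
    (Ideal.toIdeal_homogeneousCore_le _ Q))
  rw [← hI.toIdeal_homogeneousCore_eq_self]
  exact Ideal.homogeneousCore_mono _ (Ideal.IsMinimalPrime.le hQ)

/-- Vectors of the line `p`, other than `0`, are the nonzero multiples of `p.rep`. -/
theorem exists_eq_smul_rep {x : Fin (n + 1) → ℂ} (hx : x ≠ 0) :
    ∃ c : ℂ, c ≠ 0 ∧ (Projectivization.mk ℂ x hx).rep = c • x := by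
  obtain ⟨u, hu⟩ := Projectivization.exists_smul_eq_mk_rep ℂ x hx
  exact ⟨u, u.ne_zero, hu.symm⟩

theorem eval_smul_eq_zero_of_isHomogeneous {I : Ideal (MvPolynomial (Fin (n + 1)) ℂ)}
    (hI : I.IsHomogeneous (homogeneousSubmodule (Fin (n + 1)) ℂ)) {x : Fin (n + 1) → ℂ}
    (hx : ∀ f ∈ I, eval x f = 0) (c : ℂ) : ∀ f ∈ I, eval (c • x) f = 0 := by
  intro f hf
  rw [← sum_homogeneousComponent f, map_sum]
  refine Finset.sum_eq_zero fun d _ => ?_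
  rw [eval_smul_of_isHomogeneous (homogeneousComponent_isHomogeneous d f)]
  have h1 : homogeneousComponent d f ∈ I := by
    rw [← decomposition.decompose'_apply]
    exact hI d hf
  rw [hx _ h1, mul_zero]

/-- Otherwise the affine zero locus is at most the origin, the Nullstellensatz puts every variable
in Q, and the height is at least n + 1. -/
theorem exists_le_pointIdeal {Q : Ideal (MvPolynomial (Fin (n + 1)) ℂ)} [hQ : Q.IsPrime]
    (hom : Q.IsHomogeneous (homogeneousSubmodule (Fin (n + 1)) ℂ)) (hht : Q.height ≤ n) :
    ∃ p : Projectivization ℂ (Fin (n + 1) → ℂ), Q ≤ pointIdeal p.rep := by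
  by_contra! h
  have hX : ∀ i, X i ∈ Q := by
    intro i
    rw [← IsPrime.vanishingIdeal_zeroLocus (K := ℂ) Q, mem_vanishingIdeal_iff]
    intro x hx
    have hx0 : x = 0 := by
      by_contra hne
      obtain ⟨c, -, hc⟩ := exists_eq_smul_rep hne
      apply h (Projectivization.mk ℂ x hne)
      intro f hf
      rw [pointIdeal, RingHom.mem_ker, hc]
      exact eval_smul_eq_zero_of_isHomogeneous hom
        (fun f hf => by simpa [aeval_eq_eval] using hx f hf) c f hf
    simp [hx0]
  have := card_le_height_of_gradients Q (fun i : Fin (n + 1) => X i) hX (by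
    classical
    intro t ht i
    have := ht i
    simpa [pderiv_X, Pi.single_apply] using this)
  rw [Fintype.card_fin] at this
  have h2 := this.trans hht
  norm_cast at h2
  omega

variable {m : ℕ} {F : Fin m → MvPolynomial (Fin (n + 1)) ℂ}
  {A : Fin m → MvPolynomial (Fin m) ℂ} {Δ : CompleteFan m} {D : Fin m → ℤ} {e : Fin m → ℕ}

theorem IsTwistedForm.isHomogeneous_pulledIdeal (hA : IsTwistedForm Δ D A)
    (he : Δ.IsRelation fun i => (e i : ℤ)) (hF : ∀ i, (F i).IsHomogeneous (e i)) :
    (pulledIdeal F A).IsHomogeneous (homogeneousSubmodule (Fin (n + 1)) ℂ) := by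
  refine Ideal.homogeneous_span _ _ ?_
  rintro _ ⟨i, rfl⟩
  exact ⟨_, hA.isHomogeneous_aeval he hF i⟩

theorem IsTwistedForm.isHomogeneous_singularIdeal_pullback (hA : IsTwistedForm Δ D A)
    (he : Δ.IsRelation fun i => (e i : ℤ)) (hF : ∀ i, (F i).IsHomogeneous (e i)) :
    (singularIdeal (pullback F A)).IsHomogeneous (homogeneousSubmodule (Fin (n + 1)) ℂ) := by
  refine Ideal.homogeneous_span _ _ ?_
  rintro _ ⟨j, rfl⟩
  exact ⟨_, hA.isHomogeneous_pullback he hF j⟩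

/-- A nonvanishing 2×2 minor needs two distinct indices, so 2 ≤ m ≤ n and the height 2 is at most n.
-/
theorem IsLocalPair.exists_le_pointIdeal {Q : Ideal (MvPolynomial (Fin (n + 1)) ℂ)} [Q.IsPrime]
    {a b : Fin m} (h : IsLocalPair F A Q a b) (hmn : m ≤ n) (hA : IsTwistedForm Δ D A)
    (he : Δ.IsRelation fun i => (e i : ℤ)) (hF : ∀ i, (F i).IsHomogeneous (e i)) :
    ∃ p : Projectivization ℂ (Fin (n + 1) → ℂ), Q ≤ pointIdeal p.rep := by
  refine ToricPullback.exists_le_pointIdeal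
    (isHomogeneous_of_mem_minimalPrimes (hA.isHomogeneous_pulledIdeal he hF) h.minimal) ?_
  rw [h.height]
  obtain ⟨j, k, hjk⟩ := h.minor_notMem
  have hne : j ≠ k := by
    rintro rfl
    apply hjk
    rw [sub_self, map_zero]
    exact zero_mem _
  have h2 : 2 ≤ m := by
    have := j.2; have := k.2
    have : (j : ℕ) ≠ k := fun h => hne (Fin.ext h)
    omega
  exact_mod_cast h2.trans hmn

end ProjectivePoint

end ToricPullback

namespace ToricPullback

open MvPolynomial IsLocalRing

open scoped LinearAlgebra.Projectivization

variable {m n : ℕ}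

/-! ### Components through a noncritical point. -/

section Noncritical

variable {Δ : CompleteFan m} {F : Fin m → MvPolynomial (Fin (n + 1)) ℂ}
  {A : Fin m → MvPolynomial (Fin m) ℂ} {D : Fin m → ℤ} {p : ℙ ℂ (Fin (n + 1) → ℂ)}

/-- At a noncritical point, a covector is determined by its values on `Im dF` and on the radial
vector fields. -/
theorem exists_mul_mem_of_notMem_criticalSet (hp : p ∉ criticalSet Δ F)
    {I : Ideal (MvPolynomial (Fin (n + 1)) ℂ)} {μ : Fin m → MvPolynomial (Fin (n + 1)) ℂ}
    (hdF : ∀ j, ∑ i, μ i * pderiv j (F i) ∈ I)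
    (hrel : ∀ a, Δ.IsRelation a → ∑ i, μ i * (C (a i : ℂ) * F i) ∈ I) :
    ∃ s ∉ pointIdeal p.rep, ∀ i, s * μ i ∈ I := by
  classical
  -- N collects the polynomial vectors paired by μ into I. At a noncritical p their values fill ℂᵐ,
  -- so lifts of the standard basis form a matrix with determinant 1 at p; Cramer's rule with s =
  -- det concludes.
  let N : Submodule (MvPolynomial (Fin (n + 1)) ℂ) (Fin m → MvPolynomial (Fin (n + 1)) ℂ) :=
    Submodule.comap (Fintype.linearCombination (MvPolynomial (Fin (n + 1)) ℂ) μ) I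
  have hN : ∀ v, v ∈ N ↔ ∑ i, μ i * v i ∈ I := fun v => by
    simp [N, Submodule.mem_comap, Fintype.linearCombination_apply, mul_comm]
  let E : (Fin m → MvPolynomial (Fin (n + 1)) ℂ) →ₗ[ℂ] (Fin m → ℂ) :=
    (aeval (R := ℂ) p.rep).toLinearMap.compLeft (Fin m)
  have hE : ∀ v i, E v i = eval p.rep (v i) := fun v i => by
    simp [E, aeval_eq_eval]
  have htop : (N.restrictScalars ℂ).map E = ⊤ := by
    rw [criticalSet, Set.mem_ofPred_eq, not_not] at hp
    rw [eq_top_iff, ← hp, sup_le_iff]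
    constructor
    · rintro _ ⟨c, rfl⟩
      refine ⟨fun i => ∑ j, C (c j) * pderiv j (F i), ?_, ?_⟩
      · change _ ∈ N
        rw [hN]
        have : ∑ i, μ i * ∑ j, C (c j) * pderiv j (F i) =
            ∑ j, C (c j) * ∑ i, μ i * pderiv j (F i) := by
          simp only [Finset.mul_sum]
          rw [Finset.sum_comm]
          exact Finset.sum_congr rfl fun j _ => Finset.sum_congr rfl fun i _ => by ring
        rw [this]
        exact sum_mem fun j _ => Ideal.mul_mem_left _ _ (hdF j)
      · ext i
        rw [hE]
        simp [differential, Matrix.mulVec, dotProduct, mul_comm]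
    · refine Submodule.span_le.2 ?_
      rintro _ ⟨a, ha, rfl⟩
      refine ⟨fun i => C (a i : ℂ) * F i, (hN _).2 (hrel a ha), ?_⟩
      ext i
      rw [hE]
      simp [evalMap]
  have hex : ∀ i : Fin m, ∃ v ∈ N, E v = Pi.single i 1 := fun i => by
    have : Pi.single i 1 ∈ (N.restrictScalars ℂ).map E := by rw [htop]; trivial
    obtain ⟨v, hv, h⟩ := this
    exact ⟨v, hv, h⟩
  choose V hVN hVE using hex
  let M : Matrix (Fin m) (Fin m) (MvPolynomial (Fin (n + 1)) ℂ) := Matrix.of V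
  refine ⟨M.det, ?_, fun i => ?_⟩
  · rw [pointIdeal, RingHom.mem_ker, RingHom.map_det]
    have : (eval p.rep).mapMatrix M = 1 := by
      ext i k
      have e : eval p.rep (V i k) = (Pi.single i 1 : Fin m → ℂ) k := by rw [← hE, hVE]
      simp only [M, RingHom.mapMatrix_apply, Matrix.map_apply, Matrix.of_apply, e,
        Matrix.one_apply, Pi.single_apply, eq_comm]
    rw [this, Matrix.det_one]
    exact one_ne_zero
  · have h1 : M.adjugate.mulVec (M.mulVec μ) = M.det • μ := by
      rw [Matrix.mulVec_mulVec, Matrix.adjugate_mul, Matrix.smul_mulVec, Matrix.one_mulVec]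
    have h2 := congrFun h1 i
    rw [Pi.smul_apply, smul_eq_mul] at h2
    rw [← h2, Matrix.mulVec, dotProduct]
    refine sum_mem fun k _ => Ideal.mul_mem_left _ _ ?_
    have := (hN _).1 (hVN k)
    simpa [M, Matrix.mulVec, dotProduct, mul_comm] using this

theorem sum_aeval_pderiv_mul_relation (hA : IsTwistedForm Δ D A) {a : Fin m → ℤ}
    (ha : Δ.IsRelation a) (i : Fin m) :
    ∑ k, aeval F (pderiv k (A i)) * (C (a k : ℂ) * F k) =
      C ((∑ k, a k * D k - a i : ℤ) : ℂ) * aeval F (A i) := by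
  have h := congrArg (aeval F) (hA.euler ha i)
  simp only [map_sum, map_mul, aeval_X, aeval_C, algebraMap_eq] at h
  rw [← h]
  exact Finset.sum_congr rfl fun k _ => by ring

/-- The ideal `⟨A₁(F), …, Aₘ(F)⟩` is reduced along its components through noncritical points. -/
theorem IsLocalPair.exists_mul_mem_of_notMem_criticalSet
    {Q : Ideal (MvPolynomial (Fin (n + 1)) ℂ)} [Q.IsPrime] {a b : Fin m}
    (h : IsLocalPair F A Q a b) (hA : IsTwistedForm Δ D A) (hp : p ∉ criticalSet Δ F)
    (hQp : Q ≤ pointIdeal p.rep) : ∀ q ∈ Q, ∃ s ∉ Q, s * q ∈ pulledIdeal F A := by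
  have hprime : Q.IsPrime := inferInstance
  have hI : ∀ i, aeval F (A i) ∈ pulledIdeal F A := fun i =>
    aeval_mem_pulledIdeal (mem_singularIdeal A i)
  have key := exists_mul_mem_span_of_gradients Q ![aeval F (A a), aeval F (A b)]
    (fun i => by fin_cases i <;> exact h.le (hI _)) ?_ (by rw [h.height]; simp)
  · intro q hq
    obtain ⟨s, hs, hsq⟩ := key q hq
    refine ⟨s, hs, Ideal.span_le.2 ?_ hsq⟩
    rintro _ ⟨i, rfl⟩
    fin_cases i <;> exact hI _
  · intro t ht
    simp only [Fin.sum_univ_two, Matrix.cons_val_zero, Matrix.cons_val_one] at ht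
    -- The covector t₀ dA_a + t₁ dA_b at F. Modulo Q it kills Im dF by assumption and the radial
    -- fields by Euler's formula, so it vanishes; a nonvanishing minor then forces t₀, t₁ into Q.
    let μ : Fin m → MvPolynomial (Fin (n + 1)) ℂ := fun i =>
      t 0 * aeval F (pderiv i (A a)) + t 1 * aeval F (pderiv i (A b))
    have hμ : ∀ i, μ i ∈ Q := by
      obtain ⟨s, hs, hsμ⟩ := ToricPullback.exists_mul_mem_of_notMem_criticalSet hp (I := Q) (μ := μ)
        (fun j => by
          have := ht j
          rw [pderiv_aeval, pderiv_aeval] at this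
          convert this using 1
          simp only [μ, add_mul, Finset.sum_add_distrib, Finset.mul_sum, mul_assoc])
        (fun c hc => by
          have e : ∑ i, μ i * (C (c i : ℂ) * F i) =
              t 0 * ∑ k, aeval F (pderiv k (A a)) * (C (c k : ℂ) * F k) +
              t 1 * ∑ k, aeval F (pderiv k (A b)) * (C (c k : ℂ) * F k) := by
            simp only [μ, add_mul, Finset.sum_add_distrib, Finset.mul_sum, mul_assoc]
          rw [e, sum_aeval_pderiv_mul_relation hA hc, sum_aeval_pderiv_mul_relation hA hc]
          exact add_mem (Ideal.mul_mem_left _ _ (Ideal.mul_mem_left _ _ (h.le (hI a))))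
            (Ideal.mul_mem_left _ _ (Ideal.mul_mem_left _ _ (h.le (hI b)))))
      exact fun i => (hprime.mem_or_mem (hsμ i)).resolve_left fun h => hs (hQp h)
    obtain ⟨j, k, hjk⟩ := h.minor_notMem
    have h0 : t 0 * aeval F (pderiv j (A a) * pderiv k (A b) - pderiv k (A a) * pderiv j (A b))
        ∈ Q := by
      have := sub_mem (Ideal.mul_mem_right (aeval F (pderiv k (A b))) _ (hμ j))
        (Ideal.mul_mem_right (aeval F (pderiv j (A b))) _ (hμ k))
      convert this using 1
      simp only [μ, map_sub, map_mul]
      ring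
    have h1 : t 1 * aeval F (pderiv j (A a) * pderiv k (A b) - pderiv k (A a) * pderiv j (A b))
        ∈ Q := by
      have := sub_mem (Ideal.mul_mem_right (aeval F (pderiv j (A a))) _ (hμ k))
        (Ideal.mul_mem_right (aeval F (pderiv k (A a))) _ (hμ j))
      convert this using 1
      simp only [μ, map_sub, map_mul]
      ring
    intro i
    fin_cases i
    · exact (hprime.mem_or_mem h0).resolve_right hjk
    · exact (hprime.mem_or_mem h1).resolve_right hjk

end Noncritical

end ToricPullback

namespace ToricPullback

open MvPolynomial IsLocalRing

open scoped LinearAlgebra.Projectivization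

variable {m n : ℕ}

/-! ### Reducedness at a point, with denominators cleared. -/

section Reduced

theorem isReducedAt_iff {I : Ideal (MvPolynomial (Fin (n + 1)) ℂ)} {p : ℙ ℂ (Fin (n + 1) → ℂ)} :
    IsReducedAt I p ↔ ∀ (y : MvPolynomial (Fin (n + 1)) ℂ) (k : ℕ), y ^ k ∈ I →
      ∃ s ∉ pointIdeal p.rep, s * y ∈ I := by
  rw [IsReducedAt, ← Ideal.isRadical_iff_quotient_reduced]
  constructor
  · intro h y k hy
    rw [← algebraMap_mem_map_iff]
    refine h ⟨k, ?_⟩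
    rw [← map_pow]
    exact Ideal.mem_map_of_mem _ hy
  · rintro h x ⟨k, hk⟩
    obtain ⟨⟨y, u⟩, hyu⟩ := IsLocalization.surj (pointIdeal p.rep).primeCompl x
    have hu := IsLocalization.map_units (Localization.AtPrime (pointIdeal p.rep)) u
    have hy : algebraMap _ (Localization.AtPrime (pointIdeal p.rep)) (y ^ k) ∈ localIdeal I p := by
      rw [map_pow, ← hyu, mul_pow]
      exact Ideal.mul_mem_right _ _ hk
    rw [localIdeal, algebraMap_mem_map_iff] at hy
    obtain ⟨t, ht, hty⟩ := hy
    obtain ⟨s, hs, hsy⟩ := h (t * y) (k + 1) (by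
      rw [show (t * y) ^ (k + 1) = (t ^ k * y) * (t * y ^ k) by ring]
      exact Ideal.mul_mem_left _ _ hty)
    have h2 : algebraMap _ (Localization.AtPrime (pointIdeal p.rep)) y ∈ localIdeal I p := by
      rw [localIdeal, algebraMap_mem_map_iff]
      exact ⟨s * t, fun h => (Ideal.IsPrime.mem_or_mem inferInstance h).elim hs ht,
        by rwa [mul_assoc]⟩
    rwa [← hyu, mul_comm, Ideal.unit_mul_mem_iff_mem _ hu] at h2

theorem IsReducedAt.exists_mul_mem {I : Ideal (MvPolynomial (Fin (n + 1)) ℂ)}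
    {p : ℙ ℂ (Fin (n + 1) → ℂ)} (h : IsReducedAt I p) {Q : Ideal (MvPolynomial (Fin (n + 1)) ℂ)}
    [Q.IsPrime] (hQ : Q ≤ pointIdeal p.rep) {s y : MvPolynomial (Fin (n + 1)) ℂ} {k : ℕ}
    (hs : s ∉ Q) (hy : s * y ^ k ∈ I) : ∃ s ∉ Q, s * y ∈ I := by
  obtain ⟨t, ht, hty⟩ := isReducedAt_iff.1 h (s * y) (k + 1) (by
    rw [show (s * y) ^ (k + 1) = (s ^ k * y) * (s * y ^ k) by ring]
    exact Ideal.mul_mem_left _ _ hy)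
  exact ⟨t * s, fun h => (Ideal.IsPrime.mem_or_mem inferInstance h).elim (fun h => ht (hQ h)) hs,
    by rwa [mul_assoc]⟩

end Reduced

/-! ### Removing the common factor of a family. -/

section CommonFactor

/-- A finite family of elements of a factorial ring is a multiple of one whose zero locus has
codimension two. -/
theorem exists_eq_mul_of_ufd {R ι : Type*} [CommRing R] [IsDomain R] [IsNoetherianRing R]
    [UniqueFactorizationMonoid R] [Fintype ι] [Nonempty ι] (x : ι → R) :
    ∃ (f : R) (w : ι → R), (∀ i, x i = f * w i) ∧ (f = 0 → ∀ i, w i = 1) ∧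
      ∀ (Q : Ideal R), Q.IsPrime → (∀ i, w i ∈ Q) → 2 ≤ Q.height := by
  classical
  -- For the zero family take f = 0 and w = 1, so that no prime contains w.
  by_cases h0 : ∀ i, x i = 0
  · refine ⟨0, fun _ => 1, by simp [h0], by simp, fun Q hQ h => ?_⟩
    exact absurd ((Ideal.eq_top_iff_one Q).2 (h (Classical.arbitrary ι))) hQ.ne_top
  obtain ⟨_⟩ : Nonempty (NormalizedGCDMonoid R) := inferInstance
  obtain ⟨w, hw, hgcd⟩ := Finset.extract_gcd x (Finset.univ_nonempty (α := ι))
  refine ⟨Finset.univ.gcd x, w, fun i => hw i (Finset.mem_univ i), fun h => ?_, fun Q hQ h => ?_⟩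
  · exact absurd (fun i => Finset.gcd_eq_zero_iff.1 h i (Finset.mem_univ i)) h0
  · have hne : Q ≠ ⊥ := by
      rintro rfl
      have : Finset.univ.gcd w = 0 := Finset.gcd_eq_zero_iff.2 fun i _ => h i
      rw [this] at hgcd
      exact zero_ne_one hgcd
    -- Either 0 ⊂ (π) ⊂ Q is a strict chain, or Q = (π) and π divides the gcd of the w_i, which is
    -- 1.
    obtain ⟨π, hπQ, hπ⟩ := hQ.exists_mem_prime_of_ne_bot hne
    have hπprime : (Ideal.span {π}).IsPrime := (Ideal.span_singleton_prime hπ.ne_zero).2 hπ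
    have hle : Ideal.span {π} ≤ Q := (Ideal.span_singleton_le_iff_mem _).2 hπQ
    have hbot : (⊥ : Ideal R) < Ideal.span {π} :=
      bot_lt_iff_ne_bot.2 (by rw [Ne, Ideal.span_singleton_eq_bot]; exact hπ.ne_zero)
    rcases hle.lt_or_eq with hlt | heq
    · have h1 := Ideal.height_add_one_le_of_lt_of_isPrime hbot
      have h2 := Ideal.height_add_one_le_of_lt_of_isPrime hlt
      calc (2 : ℕ∞) = 0 + 1 + 1 := by norm_num
        _ ≤ (⊥ : Ideal R).height + 1 + 1 := by gcongr; exact bot_le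
        _ ≤ Q.height := (add_le_add_left h1 1).trans h2
    · have hdvd : π ∣ Finset.univ.gcd w := Finset.dvd_gcd fun i _ =>
        Ideal.mem_span_singleton.1 (heq ▸ h i)
      rw [hgcd] at hdvd
      exact absurd (isUnit_of_dvd_one hdvd) hπ.not_isUnit

end CommonFactor

/-! ### Ideals invariant under derivations. -/

section Derivations

variable {R : Type*} [CommRing R] [Algebra ℂ R] {N Q : Ideal R}

/-- Take the least k with q^k ∈ N. Applying d gives k q^(k-1) dq ∈ N; if dq were outside Q,
characteristic zero would give q^(k-1) ∈ N. -/
theorem derivation_mem_of_pow_mem [Q.IsPrime] (hNQ : N ≤ Q) (hloc : ∀ s ∉ Q, ∀ x, s * x ∈ N → x ∈ N)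
    {d : Derivation ℂ R R} (hd : ∀ x ∈ N, d x ∈ N) {q : R} (hq : ∃ k, q ^ k ∈ N) : d q ∈ Q := by
  classical
  by_contra hdq
  have hk := Nat.find_spec hq
  have hmin := fun l => Nat.find_min (m := l) hq
  revert hk hmin
  generalize Nat.find hq = k
  intro hk hmin
  rcases k with - | k
  · rw [pow_zero] at hk
    exact Ideal.IsPrime.ne_top ‹_› ((Ideal.eq_top_iff_one Q).2 (hNQ hk))
  · refine hmin k (Nat.lt_succ_self k) (hloc (d q) hdq _ ?_)
    have h1 := hd _ hk
    rw [Derivation.leibniz_pow, Nat.add_sub_cancel, smul_eq_mul] at h1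
    have h2 := Ideal.mul_mem_left _ (algebraMap ℂ R ((k + 1 : ℕ) : ℂ)⁻¹) h1
    rw [nsmul_eq_mul, ← mul_assoc, ← map_natCast (algebraMap ℂ R) (k + 1), ← map_mul,
      inv_mul_cancel₀ (Nat.cast_ne_zero.2 k.succ_ne_zero), map_one, one_mul] at h2
    rwa [mul_comm]

theorem derivation_mem_of_generators {a b : R} (hloc : ∀ s ∉ Q, ∀ x, s * x ∈ N → x ∈ N)
    (haN : a ∈ N) (hbN : b ∈ N) (hgen : ∀ x ∈ N, ∃ s ∉ Q, s * x ∈ Ideal.span {a, b})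
    {d : Derivation ℂ R R} (hda : d a ∈ N) (hdb : d b ∈ N) : ∀ x ∈ N, d x ∈ N := by
  intro x hx
  obtain ⟨s, hs, hsx⟩ := hgen x hx
  obtain ⟨u, v, huv⟩ := Ideal.mem_span_pair.1 hsx
  have h1 := congrArg d huv
  simp only [map_add, Derivation.leibniz, smul_eq_mul] at h1
  refine hloc s hs _ ?_
  have h2 : s * d x = u * d a + a * d u + (v * d b + b * d v) - x * d s := by
    linear_combination -h1
  rw [h2]
  exact sub_mem (add_mem (add_mem (Ideal.mul_mem_left _ _ hda) (Ideal.mul_mem_right _ _ haN))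
    (add_mem (Ideal.mul_mem_left _ _ hdb) (Ideal.mul_mem_right _ _ hbN)))
    (Ideal.mul_mem_right _ _ hx)

/-- A prime of the polynomial ring which is invariant under all vector fields `w_c ∂_j - w_j ∂_c`
has height at most one. -/
theorem height_le_one_of_derivations {σ : Type*} [Fintype σ] (Q : Ideal (MvPolynomial σ ℂ))
    [Q.IsPrime] {w : σ → MvPolynomial σ ℂ} {c : σ} (hc : w c ∉ Q)
    (h : ∀ j, ∀ q ∈ Q, w c * pderiv j q - w j * pderiv c q ∈ Q) : Q.height ≤ 1 := by
  obtain ⟨k, f, hf⟩ := Submodule.fg_iff_exists_fin_generating_family.1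
    (IsNoetherian.noetherian Q)
  have hfQ : ∀ i, f i ∈ Q := fun i => by
    rw [← hf]
    exact Submodule.subset_span ⟨i, rfl⟩
  refine (height_le_rank_jacobian Q f hfQ fun q hq => ⟨1, ?_, ?_⟩).trans ?_
  · exact fun h => Ideal.IsPrime.ne_top ‹_› ((Ideal.eq_top_iff_one Q).2 h)
  · rw [one_mul]
    change q ∈ Submodule.span _ _
    rwa [hf]
  · let ρ := algebraMap (MvPolynomial σ ℂ) Q.ResidueField
    have hρ : ρ (w c) ≠ 0 := fun h => hc (Ideal.algebraMap_residueField_eq_zero.1 h)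
    have := rank_le_one_of_rows (Matrix.of fun i j => ρ (pderiv j (f i))) (fun j => ρ (w j))
      fun i => ⟨ρ (pderiv c (f i)) / ρ (w c), fun j => by
        have h1 := Ideal.algebraMap_residueField_eq_zero.2 (h j (f i) (hfQ i))
        rw [map_sub, map_mul, map_mul, sub_eq_zero] at h1
        rw [Matrix.of_apply, div_mul_eq_mul_div, eq_div_iff hρ]
        change ρ (w c) * ρ _ = ρ (w j) * ρ _ at h1
        linear_combination h1⟩
    exact_mod_cast this

end Derivations

end ToricPullback

namespace ToricPullback

open MvPolynomial IsLocalRing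

open scoped LinearAlgebra.Projectivization

variable {m n : ℕ}

/-! ### Components through a critical point. -/

section Critical

theorem mem_minimalPrimes_of_height {R : Type*} [CommRing R] {W Q : Ideal R} [hQ : Q.IsPrime]
    (hWQ : W ≤ Q) (hht : Q.height = 2)
    (h : ∀ P : Ideal R, P.IsPrime → W ≤ P → 2 ≤ P.height) : Q ∈ W.minimalPrimes := by
  obtain ⟨P, hP, hle⟩ := Ideal.exists_minimalPrimes_le hWQ
  have hprime : P.IsPrime := Ideal.IsMinimalPrime.isPrime hP
  rcases hle.lt_or_eq with hlt | rfl
  · have h4 := Ideal.height_add_one_le_of_lt_of_isPrime hlt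
    have h5 : (2 : ℕ∞) + 1 ≤ 2 :=
      (add_le_add_left (h P hprime (Ideal.IsMinimalPrime.le hP)) 1).trans (h4.trans hht.le)
    exact absurd h5 (by decide)
  · exact hP

variable {Δ : CompleteFan m} {F : Fin m → MvPolynomial (Fin (n + 1)) ℂ}
  {A : Fin m → MvPolynomial (Fin m) ℂ} {D : Fin m → ℤ} {p : ℙ ℂ (Fin (n + 1) → ℂ)}

/-- Coefficients of `i_{∂_b} dα` pulled back along `F`, with respect to `dx_j`. -/
noncomputable def curlForm (F : Fin m → MvPolynomial (Fin (n + 1)) ℂ)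
    (A : Fin m → MvPolynomial (Fin m) ℂ) (b : Fin m) (j : Fin (n + 1)) :
    MvPolynomial (Fin (n + 1)) ℂ :=
  ∑ l, aeval F (curl A b l) * pderiv j (F l)

theorem IsTwistedForm.curl_mul_pullback (hA : IsTwistedForm Δ D A) (a b : Fin m)
    (j : Fin (n + 1)) : aeval F (curl A a b) * pullback F A j =
      -(aeval F (A a) * curlForm F A b j) + aeval F (A b) * curlForm F A a j := by
  simp only [pullback, curlForm, Finset.mul_sum]
  rw [← Finset.sum_neg_distrib, ← Finset.sum_add_distrib]
  refine Finset.sum_congr rfl fun i _ => ?_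
  have h := congrArg (aeval F) (hA.curl_mul_mem_span_pair a b i)
  simp only [map_mul, map_add, map_neg] at h
  linear_combination (pderiv j (F i)) * h

theorem IsTwistedForm.curl_mul_pderiv_aeval_left (hA : IsTwistedForm Δ D A) (a b : Fin m)
    (j : Fin (n + 1)) : aeval F (curl A a b) * pderiv j (aeval F (A a)) -
      (-(aeval F (pderiv a (A a)) * curlForm F A b j) +
        aeval F (pderiv b (A a)) * curlForm F A a j) ∈ pulledIdeal F A := by
  rw [pderiv_aeval]
  simp only [curlForm, Finset.mul_sum]
  rw [← Finset.sum_neg_distrib, ← Finset.sum_add_distrib, ← Finset.sum_sub_distrib]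
  refine sum_mem fun l _ => ?_
  have h := Ideal.mul_mem_right (pderiv j (F l)) _
    (aeval_mem_pulledIdeal (F := F) (hA.curl_mul_pderiv_left a b l))
  convert h using 1
  simp only [map_mul, map_add, map_neg, map_sub]
  ring

theorem IsTwistedForm.curl_mul_pderiv_aeval_right (hA : IsTwistedForm Δ D A) (a b : Fin m)
    (j : Fin (n + 1)) : aeval F (curl A a b) * pderiv j (aeval F (A b)) -
      (-(aeval F (pderiv a (A b)) * curlForm F A b j) +
        aeval F (pderiv b (A b)) * curlForm F A a j) ∈ pulledIdeal F A := by
  rw [pderiv_aeval]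
  simp only [curlForm, Finset.mul_sum]
  rw [← Finset.sum_neg_distrib, ← Finset.sum_add_distrib, ← Finset.sum_sub_distrib]
  refine sum_mem fun l _ => ?_
  have h := Ideal.mul_mem_right (pderiv j (F l)) _
    (aeval_mem_pulledIdeal (F := F) (hA.curl_mul_pderiv_right a b l))
  convert h using 1
  simp only [map_mul, map_add, map_neg, map_sub]
  ring

variable {Q : Ideal (MvPolynomial (Fin (n + 1)) ℂ)} [Q.IsPrime] {a b : Fin m}

/-- Koszul relation for the regular sequence `A_a(F), A_b(F)`. -/
theorem IsLocalPair.exists_mul_mem_of_relation (h : IsLocalPair F A Q a b)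
    {u v : MvPolynomial (Fin (n + 1)) ℂ}
    (huv : -(aeval F (A a) * u) + aeval F (A b) * v = 0) :
    (∃ s ∉ Q, s * u ∈ pulledIdeal F A) ∧ ∃ s ∉ Q, s * v ∈ pulledIdeal F A := by
  let L := Localization.AtPrime Q
  let ι := algebraMap (MvPolynomial (Fin (n + 1)) ℂ) L
  have hI : ∀ i, ι (aeval F (A i)) ∈ (pulledIdeal F A).map ι := fun i =>
    Ideal.mem_map_of_mem _ (aeval_mem_pulledIdeal (mem_singularIdeal A i))
  have h1 : ι (aeval F (A b)) * ι v = ι (aeval F (A a)) * ι u := by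
    rw [← map_mul, ← map_mul]
    congr 1
    linear_combination huv
  have h2 := h.regular_right (ι v) (Ideal.mem_span_singleton'.2 ⟨ι u, by
    change _ = ι (aeval F (A b)) * ι v
    rw [h1, mul_comm]⟩)
  obtain ⟨r, hr⟩ := Ideal.mem_span_singleton'.1 h2
  change r * ι (aeval F (A a)) = ι v at hr
  have h3 : ι u - ι (aeval F (A b)) * r = 0 := h.regular_left _ (by
    change ι (aeval F (A a)) * _ = 0
    rw [mul_sub, ← h1, ← hr]
    ring)
  rw [← algebraMap_mem_map_iff, ← algebraMap_mem_map_iff]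
  constructor
  · change ι u ∈ _
    rw [sub_eq_zero.1 h3]
    exact Ideal.mul_mem_right _ _ (hI b)
  · change ι v ∈ _
    rw [← hr]
    exact Ideal.mul_mem_left _ _ (hI a)

/-- If `ω = f w`, then `w` vanishes along `Q`: otherwise the gradients of the elements of `Q`
would all be parallel to `w`. -/
theorem IsLocalPair.mem_of_pullback_eq_mul (h : IsLocalPair F A Q a b) (hA : IsTwistedForm Δ D A)
    {w : Fin (n + 1) → MvPolynomial (Fin (n + 1)) ℂ} {f : MvPolynomial (Fin (n + 1)) ℂ}
    (hw : ∀ j, pullback F A j = f * w j) (c : Fin (n + 1)) : w c ∈ Q := by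
  by_contra hc
  have hprime : Q.IsPrime := inferInstance
  -- The Q-primary component of I; `hloc` says that it is saturated with respect to the complement
  -- of Q.
  let N : Ideal (MvPolynomial (Fin (n + 1)) ℂ) :=
    ((pulledIdeal F A).map (algebraMap _ (Localization.AtPrime Q))).comap (algebraMap _ _)
  have hN : ∀ x, x ∈ N ↔ ∃ s ∉ Q, s * x ∈ pulledIdeal F A := fun x =>
    algebraMap_mem_map_iff _ _ x
  have hIN : pulledIdeal F A ≤ N := Ideal.le_comap_map
  have hloc : ∀ s ∉ Q, ∀ x, s * x ∈ N → x ∈ N := by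
    intro s hs x hx
    obtain ⟨t, ht, htx⟩ := (hN _).1 hx
    exact (hN _).2 ⟨t * s, fun h => (hprime.mem_or_mem h).elim ht hs, by rwa [mul_assoc]⟩
  have hNQ : N ≤ Q := by
    intro x hx
    obtain ⟨t, ht, htx⟩ := (hN _).1 hx
    exact (hprime.mem_or_mem (h.le htx)).resolve_left ht
  have hmem : ∀ i, aeval F (A i) ∈ N := fun i =>
    hIN (aeval_mem_pulledIdeal (mem_singularIdeal A i))
  have hgen : ∀ x ∈ N, ∃ s ∉ Q, s * x ∈ Ideal.span {aeval F (A a), aeval F (A b)} := by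
    intro x hx
    obtain ⟨t, ht, htx⟩ := (hN _).1 hx
    obtain ⟨s, hs, hsx⟩ := h.exists_mul_mem_span_pair hA htx
    exact ⟨s * t, fun h => (hprime.mem_or_mem h).elim hs ht, by rwa [mul_assoc]⟩
  have hle : Q.height ≤ 1 := by
    refine height_le_one_of_derivations Q hc fun j q hq => ?_
    let d : Derivation ℂ (MvPolynomial (Fin (n + 1)) ℂ) (MvPolynomial (Fin (n + 1)) ℂ) :=
      w c • pderiv j - w j • pderiv c
    have hd : ∀ x, d x = w c * pderiv j x - w j * pderiv c x := fun x => rfl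
    -- Since w_c ω_j = w_j ω_c, writing (dα)_ab ω in terms of A_a(F) and A_b(F) yields a syzygy of
    -- the regular pair. Its coefficients therefore lie in N, so d preserves N and hence Q.
    have hrel : -(aeval F (A a) * (w c * curlForm F A b j - w j * curlForm F A b c)) +
        aeval F (A b) * (w c * curlForm F A a j - w j * curlForm F A a c) = 0 := by
      have e1 := hA.curl_mul_pullback (F := F) a b j
      have e2 := hA.curl_mul_pullback (F := F) a b c
      rw [hw] at e1 e2
      linear_combination w j * e2 - w c * e1
    obtain ⟨hu, hv⟩ := h.exists_mul_mem_of_relation hrel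
    rw [← hN] at hu hv
    have hda : d (aeval F (A a)) ∈ N := by
      refine hloc _ h.curl_notMem _ ?_
      have e1 := Ideal.mul_mem_left _ (w c) (hIN (hA.curl_mul_pderiv_aeval_left (F := F) a b j))
      have e2 := Ideal.mul_mem_left _ (w j) (hIN (hA.curl_mul_pderiv_aeval_left (F := F) a b c))
      have e3 := add_mem (sub_mem e1 e2)
        (add_mem (neg_mem (Ideal.mul_mem_left _ (aeval F (pderiv a (A a))) hu))
          (Ideal.mul_mem_left _ (aeval F (pderiv b (A a))) hv))
      convert e3 using 1
      rw [hd]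
      ring
    have hdb : d (aeval F (A b)) ∈ N := by
      refine hloc _ h.curl_notMem _ ?_
      have e1 := Ideal.mul_mem_left _ (w c) (hIN (hA.curl_mul_pderiv_aeval_right (F := F) a b j))
      have e2 := Ideal.mul_mem_left _ (w j) (hIN (hA.curl_mul_pderiv_aeval_right (F := F) a b c))
      have e3 := add_mem (sub_mem e1 e2)
        (add_mem (neg_mem (Ideal.mul_mem_left _ (aeval F (pderiv a (A b))) hu))
          (Ideal.mul_mem_left _ (aeval F (pderiv b (A b))) hv))
      convert e3 using 1
      rw [hd]
      ring
    obtain ⟨s, hs, k, hsk⟩ := exists_mul_pow_mem h.minimal hq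
    exact derivation_mem_of_pow_mem hNQ hloc
      (derivation_mem_of_generators hloc (hmem a) (hmem b) hgen hda hdb)
      ⟨k, (hN _).2 ⟨s, hs, hsk⟩⟩
  rw [h.height] at hle
  exact absurd hle (by decide)

/-- The ideal `⟨A₁(F), …, Aₘ(F)⟩` is reduced along its components on which `Sing(ω)` has a reduced
point. -/
theorem IsLocalPair.exists_mul_mem_of_isReducedAt (h : IsLocalPair F A Q a b)
    (hA : IsTwistedForm Δ D A) (hred : IsReducedAt (singularIdeal (pullback F A)) p)
    (hQp : Q ≤ pointIdeal p.rep) : ∀ q ∈ Q, ∃ s ∉ Q, s * q ∈ pulledIdeal F A := by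
  have hprime : Q.IsPrime := inferInstance
  obtain ⟨f, w, hfw, hf0, hht⟩ := exists_eq_mul_of_ufd (pullback F A)
  have hwQ : ∀ j, w j ∈ Q := h.mem_of_pullback_eq_mul hA hfw
  let W := Ideal.span (Set.range w)
  have hWQ : W ≤ Q := Ideal.span_le.2 (by rintro _ ⟨j, rfl⟩; exact hwQ j)
  have hQW : Q ∈ W.minimalPrimes := mem_minimalPrimes_of_height hWQ h.height
    fun P hP hWP => hht P hP fun j => hWP (Ideal.subset_span ⟨j, rfl⟩)
  have hspan : singularIdeal (pullback F A) = Ideal.span {f} * W := by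
    rw [Ideal.span_mul_span', singularIdeal]
    congr 1
    ext x
    simp only [Set.mem_range, Set.mem_mul, Set.mem_singleton_iff, exists_eq_left, hfw]
    constructor
    · rintro ⟨j, rfl⟩
      exact ⟨w j, ⟨j, rfl⟩, rfl⟩
    · rintro ⟨_, ⟨j, rfl⟩, rfl⟩
      exact ⟨j, rfl⟩
  have hmul : ∀ x ∈ W, f * x ∈ singularIdeal (pullback F A) := fun x hx => by
    rw [hspan]
    exact Ideal.mul_mem_mul (Ideal.mem_span_singleton_self f) hx
  -- If f ∈ Q, some s f^(k+1) with s ∉ Q lies in f W = J(ω). Reducedness gives t f ∈ f W with t ∉ Q,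
  -- and cancelling f puts t in W ⊆ Q.
  have hfQ : f ∉ Q := by
    intro hf
    obtain ⟨s, hs, k, hsk⟩ := exists_mul_pow_mem hQW hf
    obtain ⟨t, ht, htf⟩ := hred.exists_mul_mem hQp (k := k + 1) hs (y := f) (by
      rw [show s * f ^ (k + 1) = f * (s * f ^ k) by ring]
      exact hmul _ hsk)
    rw [hspan, Ideal.mem_span_singleton_mul] at htf
    obtain ⟨z, hz, hzt⟩ := htf
    have hfne : f ≠ 0 := fun h0 =>
      hprime.ne_top ((Ideal.eq_top_iff_one Q).2 (hf0 h0 0 ▸ hwQ 0))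
    have : z = t := mul_left_cancel₀ hfne (by rw [hzt, mul_comm])
    exact ht (this ▸ hWQ hz)
  intro q hq
  -- Now f is a unit at Q and powers of q lie in W there, hence in J(ω); reducedness removes the
  -- exponent.
  obtain ⟨s, hs, k, hsk⟩ := exists_mul_pow_mem hQW hq
  obtain ⟨t, ht, htq⟩ := hred.exists_mul_mem hQp (s := f * s) (k := k) (y := q)
    (fun h => (hprime.mem_or_mem h).elim hfQ hs) (by rw [mul_assoc]; exact hmul _ hsk)
  exact ⟨t, ht, singularIdeal_pullback_le htq⟩

end Critical

end ToricPullback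

namespace ToricPullback

open MvPolynomial

open scoped LinearAlgebra.Projectivization

variable {m n : ℕ}

/-! ### Radicality of I and the Kupka ideal. -/

section KupkaIdeal

variable {Δ : CompleteFan m} {F : Fin m → MvPolynomial (Fin (n + 1)) ℂ}
  {A : Fin m → MvPolynomial (Fin m) ℂ} {D : Fin m → ℤ} {e : Fin m → ℕ}

/-- The associated primes of `⟨A₁(F), …, Aₘ(F)⟩` are reduced components of codimension two. -/
theorem IsGenericPair.exists_isLocalPair (hgen : IsGenericPair Δ F A) (hmn : m ≤ n)
    (hA : IsTwistedForm Δ D A) (he : Δ.IsRelation fun i => (e i : ℤ))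
    (hF : ∀ i, (F i).IsHomogeneous (e i))
    (hflat : (aeval F : MvPolynomial (Fin m) ℂ →ₐ[ℂ] MvPolynomial (Fin (n + 1)) ℂ).toRingHom.Flat)
    {Q : Ideal (MvPolynomial (Fin (n + 1)) ℂ)} [Q.IsPrime] {g : MvPolynomial (Fin (n + 1)) ℂ}
    (hg : ∀ q, q * g ∈ pulledIdeal F A ↔ q ∈ Q) :
    ∃ a b, IsLocalPair F A Q a b ∧ ∀ q ∈ Q, ∃ s ∉ Q, s * q ∈ pulledIdeal F A := by
  obtain ⟨a, b, h⟩ := hA.exists_isLocalPair hflat hgen.radical hgen.codim_singular hgen.codim_d hg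
  obtain ⟨p, hp⟩ := h.exists_le_pointIdeal hmn hA he hF
  refine ⟨a, b, h, ?_⟩
  by_cases hcrit : p ∈ criticalSet Δ F
  · exact h.exists_mul_mem_of_isReducedAt hA (hgen.reduced_along p hcrit) hp
  · exact h.exists_mul_mem_of_notMem_criticalSet hA hcrit hp

theorem IsGenericPair.isRadical_pulledIdeal (hgen : IsGenericPair Δ F A) (hmn : m ≤ n)
    (hA : IsTwistedForm Δ D A) (he : Δ.IsRelation fun i => (e i : ℤ))
    (hF : ∀ i, (F i).IsHomogeneous (e i))
    (hflat : (aeval F : MvPolynomial (Fin m) ℂ →ₐ[ℂ]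
      MvPolynomial (Fin (n + 1)) ℂ).toRingHom.Flat) : (pulledIdeal F A).IsRadical := by
  refine isRadical_of_forall_associatedPrime fun Q g hQ hg => ?_
  obtain ⟨a, b, -, h⟩ := hgen.exists_isLocalPair hmn hA he hF hflat hg
  exact h

theorem IsGenericPair.kupkaIdeal_pullback (hgen : IsGenericPair Δ F A) (hmn : m ≤ n)
    (hA : IsTwistedForm Δ D A) (he : Δ.IsRelation fun i => (e i : ℤ))
    (hF : ∀ i, (F i).IsHomogeneous (e i))
    (hflat : (aeval F : MvPolynomial (Fin m) ℂ →ₐ[ℂ]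
      MvPolynomial (Fin (n + 1)) ℂ).toRingHom.Flat) :
    kupkaIdeal (pullback F A) = pulledIdeal F A := by
  refine le_antisymm (fun x hx => ?_) hA.pulledIdeal_le_kupkaIdeal
  refine mem_of_forall_mul_mem (C := dIdeal (pullback F A)) (fun Q g hQ hg => ?_) fun c hc => ?_
  · obtain ⟨a, b, h, hloc⟩ := hgen.exists_isLocalPair hmn hA he hF hflat hg
    exact h.not_dIdeal_le hA hloc
  · rw [mul_comm]
    exact singularIdeal_pullback_le (Submodule.mem_colon.1 hx c hc)

end KupkaIdeal

/-! ### The singular scheme and its decomposition. -/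

section SingularScheme

variable {Δ : CompleteFan m} {F : Fin m → MvPolynomial (Fin (n + 1)) ℂ}
  {A : Fin m → MvPolynomial (Fin m) ℂ} {D : Fin m → ℤ} {e : Fin m → ℕ}
  {p : ℙ ℂ (Fin (n + 1) → ℂ)}

/-- Away from the critical set, `Sing(ω)` is the inverse image of `Sing(α)`. -/
theorem IsTwistedForm.exists_mul_mem_singularIdeal (hA : IsTwistedForm Δ D A)
    (hp : p ∉ criticalSet Δ F) :
    ∃ s ∉ pointIdeal p.rep, ∀ x ∈ pulledIdeal F A, s * x ∈ singularIdeal (pullback F A) := by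
  obtain ⟨s, hs, h⟩ := exists_mul_mem_of_notMem_criticalSet hp
    (I := singularIdeal (pullback F A)) (μ := fun i => aeval F (A i))
    (fun j => mem_singularIdeal (pullback F A) j) (fun a ha => by
      have h := congrArg (aeval F) (hA.descent a ha)
      simp only [map_sum, map_mul, aeval_X, aeval_C, algebraMap_eq, map_zero] at h
      convert zero_mem (singularIdeal (pullback F A)) using 1
      rw [← h]
      exact Finset.sum_congr rfl fun i _ => by ring)
  refine ⟨s, hs, fun x hx => ?_⟩
  induction hx using Submodule.span_induction with
  | mem x hx =>
    obtain ⟨i, rfl⟩ := hx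
    exact h i
  | zero => simp
  | add x y _ _ hx hy => rw [mul_add]; exact add_mem hx hy
  | smul c x _ hx => rw [smul_eq_mul, mul_left_comm]; exact Ideal.mul_mem_left _ _ hx

theorem IsGenericPair.isReducedAt (hgen : IsGenericPair Δ F A) (hA : IsTwistedForm Δ D A)
    (hrad : (pulledIdeal F A).IsRadical) (p : ℙ ℂ (Fin (n + 1) → ℂ)) :
    IsReducedAt (singularIdeal (pullback F A)) p := by
  by_cases hp : p ∈ criticalSet Δ F
  · exact hgen.reduced_along p hp
  · obtain ⟨s, hs, h⟩ := hA.exists_mul_mem_singularIdeal hp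
    exact isReducedAt_iff.2 fun y k hy =>
      ⟨s, hs, h y (hrad ⟨k, singularIdeal_pullback_le hy⟩)⟩

theorem eval_aeval_eq_eval_evalMap (x : Fin (n + 1) → ℂ) (f : MvPolynomial (Fin m) ℂ) :
    eval x (aeval F f) = eval (evalMap F x) f := by
  induction f using MvPolynomial.induction_on with
  | C a => simp [algebraMap_eq]
  | add f g hf hg => simp only [map_add, hf, hg]
  | mul_X f i hf => simp only [map_mul, hf, aeval_X, eval_X, evalMap]

theorem sum_eval_mul_differential (x c : Fin (n + 1) → ℂ) :
    ∑ i, eval (evalMap F x) (A i) * differential F x c i =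
      ∑ j, c j * eval x (pullback F A j) := by
  simp only [differential, Matrix.mulVecLin_apply, Matrix.mulVec, dotProduct, Matrix.of_apply,
    pullback, map_sum, map_mul, eval_aeval_eq_eval_evalMap, Finset.mul_sum]
  rw [Finset.sum_comm]
  exact Finset.sum_congr rfl fun j _ => Finset.sum_congr rfl fun i _ => by ring

theorem mem_projZeros_singularIdeal_iff :
    p ∈ projZeros (singularIdeal (pullback F A)) ↔ ∀ j, eval p.rep (pullback F A j) = 0 := by
  refine ⟨fun h j => h _ (mem_singularIdeal _ j), fun h f hf => ?_⟩
  have hle : singularIdeal (pullback F A) ≤ pointIdeal p.rep :=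
    Ideal.span_le.2 (by rintro _ ⟨j, rfl⟩; exact h j)
  exact hle hf

/-- The composite of α(F(p)) with dF(p) is ω(p), so tangency means the vanishing of ω at p. -/
theorem mem_tangencySet_iff : p ∈ tangencySet Δ F A ↔
    p ∈ criticalSet Δ F ∧ p ∈ projZeros (singularIdeal (pullback F A)) := by
  classical
  rw [mem_projZeros_singularIdeal_iff]
  refine and_congr_right fun _ => ⟨fun h j => ?_, ?_⟩
  · have := h _ ⟨Pi.single j 1, rfl⟩
    rw [sum_eval_mul_differential] at this
    simpa [Pi.single_apply] using this
  · rintro h _ ⟨c, rfl⟩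
    rw [sum_eval_mul_differential]
    exact Finset.sum_eq_zero fun j _ => by rw [h, mul_zero]

theorem IsTwistedForm.projZeros_singularIdeal_pullback (hA : IsTwistedForm Δ D A) :
    projZeros (singularIdeal (pullback F A)) =
      projZeros (pulledIdeal F A) ∪ tangencySet Δ F A := by
  ext p
  rw [Set.mem_union, mem_tangencySet_iff]
  constructor
  · intro h
    by_cases hp : p ∈ criticalSet Δ F
    · exact Or.inr ⟨hp, h⟩
    · left
      intro f hf
      obtain ⟨s, hs, hsf⟩ := hA.exists_mul_mem_singularIdeal hp
      have := h _ (hsf f hf)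
      rw [map_mul] at this
      exact (mul_eq_zero.1 this).resolve_left hs
  · rintro (h | h)
    · exact fun f hf => h f (singularIdeal_pullback_le hf)
    · exact h.2

attribute [local instance] MvPolynomial.gradedAlgebra

theorem mk_mem_projZeros_iff {I : Ideal (MvPolynomial (Fin (n + 1)) ℂ)}
    (hI : I.IsHomogeneous (homogeneousSubmodule (Fin (n + 1)) ℂ)) {x : Fin (n + 1) → ℂ}
    (hx : x ≠ 0) : Projectivization.mk ℂ x hx ∈ projZeros I ↔ ∀ f ∈ I, eval x f = 0 := by
  obtain ⟨c, hc, hrep⟩ := exists_eq_smul_rep hx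
  refine ⟨fun h => ?_, fun h => ?_⟩
  · have := eval_smul_eq_zero_of_isHomogeneous hI h c⁻¹
    rwa [hrep, smul_smul, inv_mul_cancel₀ hc, one_smul] at this
  · have := eval_smul_eq_zero_of_isHomogeneous hI h c
    rwa [← hrep] at this

/-- A subscheme of `ℙⁿ` which is reduced is determined by its zero set, written as a union. -/
theorem sameSubscheme_inf_idealOfSet {I K : Ideal (MvPolynomial (Fin (n + 1)) ℂ)}
    {T : Set (ℙ ℂ (Fin (n + 1) → ℂ))}
    (hI : I.IsHomogeneous (homogeneousSubmodule (Fin (n + 1)) ℂ))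
    (hK : K.IsHomogeneous (homogeneousSubmodule (Fin (n + 1)) ℂ)) (hIK : I ≤ K)
    (hred : ∀ p, IsReducedAt I p) (hunion : projZeros I = projZeros K ∪ T) :
    SameSubscheme I (K ⊓ idealOfSet T) := by
  intro p
  refine le_antisymm (Ideal.map_mono (le_inf hIK fun f hf => ?_)) ?_
  · rw [idealOfSet, mem_vanishingIdeal_iff]
    rintro x ⟨hx, hxT⟩
    rw [aeval_eq_eval]
    exact (mk_mem_projZeros_iff hI hx).1 (hunion ▸ Or.inr hxT) f hf
  · rw [localIdeal, Ideal.map_le_iff_le_comap]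
    rintro f ⟨hfK, hfT⟩
    rw [Ideal.mem_comap, localIdeal, algebraMap_mem_map_iff]
    obtain ⟨j, hj⟩ := Function.ne_iff.1 p.rep_nonzero
    -- The factor X_j vanishes at the origin, the one point of the affine cone not seen by ℙⁿ, and
    -- is a unit at p.
    have hrad : X j * f ∈ I.radical := by
      rw [← vanishingIdeal_zeroLocus_eq_radical (K := ℂ), mem_vanishingIdeal_iff]
      intro x hx
      rw [aeval_eq_eval, map_mul, eval_X]
      by_cases hx0 : x = 0
      · simp [hx0]
      · have hmem : Projectivization.mk ℂ x hx0 ∈ projZeros K ∪ T := by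
          rw [← hunion, mk_mem_projZeros_iff hI hx0]
          intro f hf
          simpa [aeval_eq_eval] using hx f hf
        rcases hmem with h | h
        · rw [(mk_mem_projZeros_iff hK hx0).1 h f hfK, mul_zero]
        · have := (mem_vanishingIdeal_iff.1 hfT) x ⟨hx0, h⟩
          rw [aeval_eq_eval] at this
          rw [this, mul_zero]
    obtain ⟨k, hk⟩ := hrad
    obtain ⟨s, hs, hsf⟩ := isReducedAt_iff.1 (hred p) _ k hk
    refine ⟨s * X j, fun h => (Ideal.IsPrime.mem_or_mem inferInstance h).elim hs fun h => hj ?_,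
      by rwa [mul_assoc]⟩
    simpa [pointIdeal, RingHom.mem_ker] using h

end SingularScheme

end ToricPullback

theorem theorem5p22 {m n : ℕ} (hmn : m ≤ n)
    (Δ : ToricPullback.CompleteFan m)
    (D : Fin m → ℤ) (A : Fin m → MvPolynomial (Fin m) ℂ)
    (hA : ToricPullback.IsTwistedForm Δ D A)
    (e : Fin m → ℕ) (he : Δ.IsRelation fun i => (e i : ℤ))
    (F : Fin m → MvPolynomial (Fin (n + 1)) ℂ) (hF : ∀ i, (F i).IsHomogeneous (e i))
    (hgen : ToricPullback.IsGenericPair Δ F A)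
    (hflat : (MvPolynomial.aeval F :
      MvPolynomial (Fin m) ℂ →ₐ[ℂ] MvPolynomial (Fin (n + 1)) ℂ).toRingHom.Flat) :
    -- the Kupka ideal of `ω = F^*α` is `⟨A₁(F), …, Aₘ(F)⟩`
    ToricPullback.kupkaIdeal (ToricPullback.pullback F A) =
        Ideal.span (Set.range fun i => MvPolynomial.aeval F (A i)) ∧
    -- the scheme `Sing(ω)` is reduced
    (∀ p, ToricPullback.IsReducedAt
        (ToricPullback.singularIdeal (ToricPullback.pullback F A)) p) ∧
    -- `Sing(ω) = 𝒦(ω) ∪ C(F, α)`, as sets and as schemes (`C(F, α)` with its reduced structure)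
    ToricPullback.projZeros (ToricPullback.singularIdeal (ToricPullback.pullback F A)) =
        ToricPullback.projZeros (ToricPullback.kupkaIdeal (ToricPullback.pullback F A)) ∪
          ToricPullback.tangencySet Δ F A ∧
    ToricPullback.SameSubscheme
        (ToricPullback.singularIdeal (ToricPullback.pullback F A))
        (ToricPullback.kupkaIdeal (ToricPullback.pullback F A) ⊓
          ToricPullback.idealOfSet (ToricPullback.tangencySet Δ F A)) := by
  have hrad := hgen.isRadical_pulledIdeal hmn hA he hF hflat
  have hK := hgen.kupkaIdeal_pullback hmn hA he hF hflat
  have hred := hgen.isReducedAt hA hrad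
  have hunion := hA.projZeros_singularIdeal_pullback (F := F)
  refine ⟨hK, hred, hK ▸ hunion, hK ▸ ?_⟩
  exact ToricPullback.sameSubscheme_inf_idealOfSet (hA.isHomogeneous_singularIdeal_pullback he hF)
    (hA.isHomogeneous_pulledIdeal he hF) ToricPullback.singularIdeal_pullback_le hred hunion
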